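/- Consider the control system $\dot x(t)=f(x(t),w(t))+G(x(t))u(t)$ with state in $\mathbb R^{n_x}$, controls $u(t)\in U\subseteq\mathbb R^{n_u}$ and disturbances $w(t)\in W\subseteq\mathbb R^{n_w}$. Assume that $U$ and $W$ are nonempty, compact and convex, that $U$ has non-empty interior, that $f$ is jointly continuous and locally Lipschitz in $x$ (every $(x_0,w_0)$ has a neighbourhood on which $f$ is Lipschitz in $x$ with one constant), and that $G$ is continuously differentiable. For a nonempty compact set $Z$ let $V[Z](c)=\max_{z\in Z}c^{\mathsf T}z$ be its support function. Let $Y(t)\subset\mathbb R^{n_x}$, $t\in[t_1,t_2]$, be nonempty compact convex sets such that, for every $c\in\mathbb R^{n_x}$, the function $t\mapsto V[Y(t)](c)$ is Lipschitz on $[t_1,t_2]$ and, for a.e. $t\in[t_1,t_2]$, $$\dot V[Y(t)](c)\ \ge\ \min_{\nu\in U}V[\Gamma(\nu,c,Y(t))](c),\qquad \Gamma(\nu,c,Z)=\{f(\xi,\omega)+G(\xi)\nu \mid \xi\in Z,\ c^{\mathsf T}\xi=V[Z](c),\ \omega\in W\}.$$ Assume in addition that $U$ and all $Y(t)$ have smooth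 boundary (near each boundary point the set is $\{g\le 0\}$ with $g$ smooth and $\nabla g\neq0$ at that point) with positive curvature everywhere: the differential of the Gauss map $\mathcal G_Z:\partial Z\to\mathcal S^{n-1}$, which maps a boundary point to its outward unit normal, is positive definite on every tangent space of $\partial Z$. Then: 1. For every $t\in[t_1,t_2]$, $\mathcal G_{Y(t)}:\partial Y(t)\to\mathcal S^{n_x-1}$ is bijective, and for every unit vector $c$ the set $\operatorname{argmax}_{\xi\in Y(t)}c^{\mathsf T}\xi$ consists of the single point $\mathcal G_{Y(t)}^{-1}(c)$. 2. For every $t\in[t_1,t_2]$ and every unit vector $c$, the set $\operatorname{argmin}_{\nu\in U}c^{\mathsf T}G(\mathcal G_{Y(t)}^{-1}(c))\nu$ is nonempty, and it is a singleton if $G(\mathcal G_{Y(t)}^{-1}(c))^{\mathsf T}c\ne0$. 3. Consider the jointly Borel measurable feedback laws $\mu:[t_1,t_2]\times\mathbb R^{n_x}\to U$ such that $$\mu(t,\xi)=\mu_t^*(\mathcal G_{Y(t)}(\xi))\quad\text{for } t\in[t_1,t_2],\ \xi\in\partial Y(t),\qquad \mu^*_t(c)\in\operatorname{argmin}_{\nu\in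 U}c^{\mathsf T}G(\mathcal G_{Y(t)}^{-1}(c))\nu\quad\text{for all unit vectors }c,$$ and which are continued outside the tube so that, for some constant $L$, $\|\mu(t,\xi)-\mu(t,p)\|\le L\|\xi-p\|$ for all $t\in[t_1,t_2]$ and $\xi\notin Y(t)$, with $p$ the point of $Y(t)$ nearest to $\xi$ (for instance, constantly along outward normals); the values in the interior of $Y(t)$ are arbitrary elements of $U$. Such feedback laws exist, and each of them keeps the trajectories in the tube: for $t_1\le s\le s'\le t_2$, every integrable $w:[s,s']\to W$ and every absolutely continuous $x$ with $\dot x(t)=f(x(t),w(t))+G(x(t))\mu(t,x(t))$ for a.e. $t\in[s,s']$, if $x(s)\in Y(s)$ then $x(s')\in Y(s')$. -/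

import Mathlib

open Set Filter Topology MeasureTheory
open scoped ContDiff InnerProductSpace

noncomputable section

namespace RobustTube

/-- Euclidean space of column vectors; `⟪c, z⟫_ℝ` is the product of the row `c` with `z`. -/
abbrev E (n : ℕ) : Type := EuclideanSpace ℝ (Fin n)

/-! ### Compact convex sets, support functions, Gauss maps -/

/-- A (nonempty) compact convex set. -/
structure IsCompactConvex {n : ℕ} (Z : Set (E n)) : Prop where
  compact : IsCompact Z
  convex : Convex ℝ Z
  nonempty : Z.Nonempty

/-- The support function of `Z` (a maximum when `Z` is nonempty and compact). -/
def support {n : ℕ} (Z : Set (E n)) (c : E n) : ℝ :=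
  sSup ((fun z => ⟪c, z⟫_ℝ) '' Z)

/-- The set of maximizers over `Z` of the linear form `c`. -/
def argmaxSet {n : ℕ} (Z : Set (E n)) (c : E n) : Set (E n) :=
  {ξ | ξ ∈ Z ∧ ∀ ζ ∈ Z, ⟪c, ζ⟫_ℝ ≤ ⟪c, ξ⟫_ℝ}

/-- `g` is a smooth defining function of `Z` near `z`: near `z`, the set `Z` is `{g ≤ 0}`,
and the gradient of `g` at `z` does not vanish. -/
def IsDefiningFunctionAt {n : ℕ} (Z : Set (E n)) (z : E n) (g : E n → ℝ) : Prop :=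
  ∃ N : Set (E n), IsOpen N ∧ z ∈ N ∧ ContDiffOn ℝ ∞ g N ∧ gradient g z ≠ 0 ∧
    ∀ y ∈ N, (y ∈ Z ↔ g y ≤ 0)

/-- `Z` is a smooth set: its boundary is a smooth hypersurface, with `Z` on one side of it. -/
def IsSmoothSet {n : ℕ} (Z : Set (E n)) : Prop :=
  ∀ z ∈ frontier Z, ∃ g, IsDefiningFunctionAt Z z g

/-- Any two defining functions have the same normalized gradient at a boundary point. -/
theorem normalized_gradient_eq {n : ℕ} {Z : Set (E n)} {z : E n} {g h : E n → ℝ}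
    (hz : z ∈ frontier Z) (hg : IsDefiningFunctionAt Z z g) (hh : IsDefiningFunctionAt Z z h) :
    ‖gradient g z‖⁻¹ • gradient g z = ‖gradient h z‖⁻¹ • gradient h z := by
  obtain ⟨N, hN, hzN, hgs, hg0, hgZ⟩ := hg
  obtain ⟨M, hM, hzM, hhs, hh0, hhZ⟩ := hh
  -- a defining function vanishes at `z`
  have key : ∀ (k : E n → ℝ) (O : Set (E n)), IsOpen O → z ∈ O → ContinuousAt k z →
      (∀ y ∈ O, (y ∈ Z ↔ k y ≤ 0)) → k z = 0 := by
    intro k O hO hzO hk hkZ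
    rcases lt_trichotomy (k z) 0 with hlt | heq | hgt
    · exfalso
      have hmem : Z ∈ 𝓝 z := by
        filter_upwards [hk.eventually (gt_mem_nhds hlt), hO.mem_nhds hzO] with y hy hyO
        exact (hkZ y hyO).2 (le_of_lt hy)
      exact hz.2 (mem_interior_iff_mem_nhds.2 hmem)
    · exact heq
    · exfalso
      have hmem : Zᶜ ∈ 𝓝 z := by
        filter_upwards [hk.eventually (lt_mem_nhds hgt), hO.mem_nhds hzO] with y hy hyO
        exact fun hyZ => absurd ((hkZ y hyO).1 hyZ) (not_le.2 hy)
      obtain ⟨y, hy1, hy2⟩ := mem_closure_iff_nhds.1 hz.1 _ hmem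
      exact hy1 hy2
  have hgd : DifferentiableAt ℝ g z :=
    (hgs.contDiffAt (hN.mem_nhds hzN)).differentiableAt (by simp)
  have hhd : DifferentiableAt ℝ h z :=
    (hhs.contDiffAt (hM.mem_nhds hzM)).differentiableAt (by simp)
  have hgz : g z = 0 := key g N hN hzN hgd.continuousAt hgZ
  have hhz : h z = 0 := key h M hM hzM hhd.continuousAt hhZ
  set a := ‖gradient g z‖⁻¹ • gradient g z with ha
  set b := ‖gradient h z‖⁻¹ • gradient h z with hb
  have hgp : 0 < ‖gradient g z‖ := norm_pos_iff.2 hg0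
  have hhp : 0 < ‖gradient h z‖ := norm_pos_iff.2 hh0
  have ha1 : ‖a‖ = 1 := by
    rw [ha, norm_smul, norm_inv, norm_norm, inv_mul_cancel₀ hgp.ne']
  have hb1 : ‖b‖ = 1 := by
    rw [hb, norm_smul, norm_inv, norm_norm, inv_mul_cancel₀ hhp.ne']
  by_contra hab
  have hlt : ⟪a, b⟫_ℝ < 1 := inner_lt_one_iff_real_of_norm_eq_one ha1 hb1 |>.2 hab
  -- along `b - a` the function `g` decreases and the function `h` increases
  have slope : ∀ k : E n → ℝ, DifferentiableAt ℝ k z →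
      HasDerivAt (fun s : ℝ => k (z + s • (b - a))) ⟪gradient k z, b - a⟫_ℝ 0 := by
    intro k hk
    have h1 : HasFDerivAt k (InnerProductSpace.toDual ℝ (E n) (gradient k z))
        (z + (0 : ℝ) • (b - a)) := by
      simpa using hk.hasGradientAt.hasFDerivAt
    have h2 : HasDerivAt (fun s : ℝ => z + s • (b - a)) (b - a) 0 := by
      simpa using ((hasDerivAt_id (0 : ℝ)).smul_const (b - a)).const_add z
    have h3 := h1.comp_hasDerivAt (0 : ℝ) h2
    rw [InnerProductSpace.toDual_apply_apply] at h3
    exact h3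
  have hga : gradient g z = ‖gradient g z‖ • a := by
    rw [ha, smul_smul, mul_inv_cancel₀ hgp.ne', one_smul]
  have hhb : gradient h z = ‖gradient h z‖ • b := by
    rw [hb, smul_smul, mul_inv_cancel₀ hhp.ne', one_smul]
  have hsg : ⟪gradient g z, b - a⟫_ℝ < 0 := by
    rw [hga, real_inner_smul_left, inner_sub_right, real_inner_self_eq_norm_sq, ha1]
    nlinarith
  have hsh : 0 < ⟪gradient h z, b - a⟫_ℝ := by
    rw [hhb, real_inner_smul_left, inner_sub_right, real_inner_self_eq_norm_sq, hb1,
      real_inner_comm]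
    nlinarith
  have hpath : ContinuousAt (fun s : ℝ => z + s • (b - a)) 0 := by fun_prop
  have e1 : ∀ᶠ s in 𝓝[>] (0 : ℝ), z + s • (b - a) ∈ N ∩ M :=
    (hpath.eventually (by
      simpa using (hN.inter hM).mem_nhds ⟨hzN, hzM⟩)).filter_mono nhdsWithin_le_nhds
  have lim : ∀ k : E n → ℝ, DifferentiableAt ℝ k z → k z = 0 →
      Tendsto (fun s : ℝ => s⁻¹ * k (z + s • (b - a))) (𝓝[>] 0) (𝓝 ⟪gradient k z, b - a⟫_ℝ) := by
    intro k hk hkz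
    have h1 := (slope k hk).tendsto_slope_zero_right
    simpa [hkz] using h1
  have e2 := (lim g hgd hgz).eventually (gt_mem_nhds hsg)
  have e3 := (lim h hhd hhz).eventually (lt_mem_nhds hsh)
  obtain ⟨s, ⟨hs1, hs2⟩, hs3, hs4, hs5⟩ :=
    (e1.and (e2.and (e3.and self_mem_nhdsWithin))).exists
  have hs0 : (0 : ℝ) < s := hs5
  have hgs' : g (z + s • (b - a)) < 0 := by
    by_contra hc
    exact absurd hs3 (not_lt.2 (mul_nonneg (inv_nonneg.2 hs0.le) (not_lt.1 hc)))
  have hhs' : 0 < h (z + s • (b - a)) := by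
    by_contra hc
    exact absurd hs4 (not_lt.2
      (mul_nonpos_of_nonneg_of_nonpos (inv_nonneg.2 hs0.le) (not_lt.1 hc)))
  exact absurd ((hhZ _ hs2).1 ((hgZ _ hs1).2 hgs'.le)) (not_le.2 hhs')

open Classical in
/-- The Gauss map of a smooth set `Z`: at a boundary point `z`, the normalized gradient of a
defining function (which one is irrelevant, see `gaussMap_eq`). Only its values on the boundary
of `Z` are meaningful. -/
def gaussMap {n : ℕ} (Z : Set (E n)) (z : E n) : E n :=
  if h : ∃ g, IsDefiningFunctionAt Z z g then
    ‖gradient h.choose z‖⁻¹ • gradient h.choose z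
  else 0

/-- The Gauss map can be computed from any defining function. -/
theorem gaussMap_eq {n : ℕ} {Z : Set (E n)} {z : E n} {g : E n → ℝ}
    (hz : z ∈ frontier Z) (hg : IsDefiningFunctionAt Z z g) :
    gaussMap Z z = ‖gradient g z‖⁻¹ • gradient g z := by
  have h : ∃ g, IsDefiningFunctionAt Z z g := ⟨g, hg⟩
  rw [gaussMap, dif_pos h]
  exact normalized_gradient_eq hz h.choose_spec hg

/-- The inverse of the Gauss map, from the unit sphere to the boundary of `Z`. -/
def invGaussMap {n : ℕ} (Z : Set (E n)) (c : E n) : E n :=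
  Function.invFunOn (gaussMap Z) (frontier Z) c

/-- `Z` has positive curvature at its boundary point `ζ`: the differential of the Gauss map along
the boundary is positive definite on the tangent space at `ζ`. (The restriction of `D` to the
tangent space is determined by the Gauss map.) -/
def HasPositiveCurvatureAt {n : ℕ} (Z : Set (E n)) (ζ : E n) : Prop :=
  ∃ D : E n →L[ℝ] E n, HasFDerivWithinAt (gaussMap Z) D (frontier Z) ζ ∧
    ∀ w : E n, ⟪gaussMap Z ζ, w⟫_ℝ = 0 → w ≠ 0 → 0 < ⟪w, D w⟫_ℝ

/-- A smooth set whose boundary has positive curvature everywhere. -/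
def IsSmoothPositivelyCurved {n : ℕ} (Z : Set (E n)) : Prop :=
  IsSmoothSet Z ∧ ∀ ζ ∈ frontier Z, HasPositiveCurvatureAt Z ζ

/-! ### The control system `x' = f(x, w) + G(x) u` -/

/-- `f` is locally Lipschitz in its first argument: near every point `(x₀, w₀)`, with a common
constant. -/
def LocallyLipschitzInState {nx nw : ℕ} (f : E nx → E nw → E nx) : Prop :=
  ∀ (x₀ : E nx) (w₀ : E nw), ∃ K : NNReal, ∃ A ∈ 𝓝 x₀, ∃ B ∈ 𝓝 w₀,
    ∀ b ∈ B, LipschitzOnWith K (fun x => f x b) A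

/-- The possible velocities `f(ξ, b) + G(ξ) ν`, with `ξ` in the face of `Z` in direction `c` and
`b` in `W`. -/
def velocitySet {nx nu nw : ℕ} (f : E nx → E nw → E nx) (G : E nx → E nu →L[ℝ] E nx)
    (W : Set (E nw)) (ν : E nu) (c : E nx) (Z : Set (E nx)) : Set (E nx) :=
  {v | ∃ ξ ∈ Z, ∃ b ∈ W, ⟪c, ξ⟫_ℝ = support Z c ∧ v = f ξ b + G ξ ν}

/-- The right-hand side of the min-max differential inequality: the minimum over `ν ∈ U` of the
support function of the velocity set. -/
def minmaxRate {nx nu nw : ℕ} (f : E nx → E nw → E nx) (G : E nx → E nu →L[ℝ] E nx)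
    (U : Set (E nu)) (W : Set (E nw)) (c : E nx) (Z : Set (E nx)) : ℝ :=
  sInf ((fun ν => support (velocitySet f G W ν c Z) c) '' U)

/-- The min-max differential inequality for the tube `Y` on `[t₁, t₂]`. The support function of
the cross-sections is Lipschitz in time, hence differentiable almost everywhere. -/
structure SatisfiesMinmaxDI {nx nu nw : ℕ} (f : E nx → E nw → E nx)
    (G : E nx → E nu →L[ℝ] E nx) (U : Set (E nu)) (W : Set (E nw))
    (t₁ t₂ : ℝ) (Y : ℝ → Set (E nx)) : Prop where
  compactConvex : ∀ t ∈ Icc t₁ t₂, IsCompactConvex (Y t)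
  lipschitz : ∀ c : E nx, ∃ K : NNReal, LipschitzOnWith K (fun t => support (Y t) c) (Icc t₁ t₂)
  inequality : ∀ c : E nx, ∀ᵐ t ∂(volume.restrict (Icc t₁ t₂)),
    minmaxRate f G U W c (Y t) ≤ deriv (fun τ => support (Y τ) c) t

/-- A disturbance on `[s, s']`: an integrable function with values in `W`. -/
def IsDisturbance {nw : ℕ} (W : Set (E nw)) (s s' : ℝ) (w : ℝ → E nw) : Prop :=
  IntegrableOn w (Icc s s') ∧ ∀ t ∈ Icc s s', w t ∈ W

/-- `x` is a (Carathéodory) solution on `[s, s']` of the system controlled by the feedback `μ`,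
with disturbance `w`. -/
def IsClosedLoopSolution {nx nu nw : ℕ} (f : E nx → E nw → E nx)
    (G : E nx → E nu →L[ℝ] E nx) (μ : ℝ → E nx → E nu) (w : ℝ → E nw)
    (s s' : ℝ) (x : ℝ → E nx) : Prop :=
  AbsolutelyContinuousOnInterval x s s' ∧
    ∀ᵐ t ∂(volume.restrict (Icc s s')),
      HasDerivAt x (f (x t) (w t) + G (x t) (μ t (x t))) t

/-- A feedback control law on `[t₁, t₂]` with values in `U`. Joint Borel measurability gives
integrability in time along every trajectory, as `U` is bounded. -/
structure IsFeedbackLaw {nx nu : ℕ} (U : Set (E nu)) (t₁ t₂ : ℝ) (μ : ℝ → E nx → E nu) :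
    Prop where
  mem : ∀ t ∈ Icc t₁ t₂, ∀ ξ, μ t ξ ∈ U
  measurable : Measurable (fun p : Icc t₁ t₂ × E nx => μ p.1 p.2)

/-- The feedback `μ` makes the tube `Y` robustly forward invariant on `[t₁, t₂]`: every solution
that is in the tube at time `s` is in the tube at every later time `s'` up to which it exists,
whatever the disturbance. -/
def KeepsInTube {nx nu nw : ℕ} (f : E nx → E nw → E nx) (G : E nx → E nu →L[ℝ] E nx)
    (W : Set (E nw)) (t₁ t₂ : ℝ) (Y : ℝ → Set (E nx)) (μ : ℝ → E nx → E nu) : Prop :=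
  ∀ s s' : ℝ, t₁ ≤ s → s ≤ s' → s' ≤ t₂ → ∀ (w : ℝ → E nw) (x : ℝ → E nx),
    IsDisturbance W s s' w → IsClosedLoopSolution f G μ w s s' x → x s ∈ Y s → x s' ∈ Y s'

/-! ### The explicit feedback -/

/-- The set of minimizers over `ν ∈ U` of `cᵀ G(𝒢⁻¹(c)) ν`, with `𝒢` the Gauss map of `Z`. -/
def argminSet {nx nu : ℕ} (G : E nx → E nu →L[ℝ] E nx) (U : Set (E nu)) (Z : Set (E nx))
    (c : E nx) : Set (E nu) :=
  {ν | ν ∈ U ∧ ∀ ν' ∈ U,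
    ⟪c, G (invGaussMap Z c) ν⟫_ℝ ≤ ⟪c, G (invGaussMap Z c) ν'⟫_ℝ}

/-- On the boundary of the tube, `μ(t, ξ) = μ*_t(𝒢_{Y(t)}(ξ))`, where `μ*_t(c)` is a minimizer of
`cᵀ G(𝒢⁻¹_{Y(t)}(c)) ν` over `ν ∈ U`. -/
def FollowsExplicitLaw {nx nu : ℕ} (G : E nx → E nu →L[ℝ] E nx) (U : Set (E nu))
    (t₁ t₂ : ℝ) (Y : ℝ → Set (E nx)) (μ : ℝ → E nx → E nu) : Prop :=
  ∃ μs : ℝ → E nx → E nu,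
    (∀ t ∈ Icc t₁ t₂, ∀ c ∈ Metric.sphere (0 : E nx) 1, μs t c ∈ argminSet G U (Y t) c) ∧
    ∀ t ∈ Icc t₁ t₂, ∀ ξ ∈ frontier (Y t), μ t ξ = μs t (gaussMap (Y t) ξ)

/-- Outside the tube, the feedback differs from its value at the nearest point of the tube by at
most a constant times the distance to the tube. It holds if `μ` is constant along the outward
normals of the cross-sections, or Lipschitz in the state outside them. -/
def LipschitzOutwards {nx nu : ℕ} (t₁ t₂ : ℝ) (Y : ℝ → Set (E nx)) (μ : ℝ → E nx → E nu) :
    Prop :=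
  ∃ L : ℝ, ∀ t ∈ Icc t₁ t₂, ∀ ξ ∉ Y t, ∀ p ∈ Y t,
    dist ξ p = Metric.infDist ξ (Y t) → ‖μ t ξ - μ t p‖ ≤ L * dist ξ p

end RobustTube

end

/-!
Outside the tube, follow the distance `‖x - p‖` from the state `x` to its nearest point `p` in
`Y(t)`, with outward normal `c`. This distance is `⟪c, x⟫ - V[Y(t)](c)`, and it is not less than
`⟪c', x⟫ - V[Y(t)](c')` for any other unit vector `c'`. With the normal frozen at a later time, the
min-max inequality therefore bounds its growth by the excess of the closed-loop velocity in the
direction `c` over the min-max rate. The feedback at `p` minimizes `cᵀ G(p) ν`, so that at `x = p`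
there is no excess, and at `x` the excess is at most a constant times `‖x - p‖` by Lipschitz
continuity. Gronwall's inequality keeps the distance at zero. The comparison needs `p` and `c` to be
continuous in time, and the maximizer in a given direction to be continuous in time and direction:
each is unique (by convexity, smoothness and positive curvature, respectively) and depends on its
data through a closed relation with bounded values.
-/

namespace RobustTube

open scoped NNReal
open ContinuousLinearMap (adjoint)

/-! ### Gauss maps of smooth convex sets -/

section GaussMap

variable {n : ℕ} {Z : Set (E n)} {z c d : E n} {g : E n → ℝ}

theorem tendsto_add_smul_nhdsGT_zero (z d : E n) :
    Tendsto (fun s : ℝ => z + s • d) (𝓝[>] 0) (𝓝 z) := by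
  have h : Continuous fun s : ℝ => z + s • d := by fun_prop
  simpa using (h.tendsto 0).mono_left nhdsWithin_le_nhds

theorem IsDefiningFunctionAt.differentiableAt (hg : IsDefiningFunctionAt Z z g) :
    DifferentiableAt ℝ g z := by
  obtain ⟨N, hN, hzN, hgs, -, -⟩ := hg
  exact (hgs.contDiffAt (hN.mem_nhds hzN)).differentiableAt (by simp)

theorem IsDefiningFunctionAt.eventually_mem_iff (hg : IsDefiningFunctionAt Z z g) :
    ∀ᶠ y in 𝓝 z, (y ∈ Z ↔ g y ≤ 0) := by
  obtain ⟨N, hN, hzN, -, -, hgZ⟩ := hg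
  filter_upwards [hN.mem_nhds hzN] with y hy using hgZ y hy

theorem IsDefiningFunctionAt.norm_gradient_pos (hg : IsDefiningFunctionAt Z z g) :
    0 < ‖gradient g z‖ := by
  obtain ⟨-, -, -, -, hg0, -⟩ := hg
  exact norm_pos_iff.2 hg0

theorem IsDefiningFunctionAt.apply_eq_zero (hg : IsDefiningFunctionAt Z z g)
    (hz : z ∈ frontier Z) : g z = 0 := by
  have hgc := hg.differentiableAt.continuousAt
  refine le_antisymm (not_lt.1 fun hpos => ?_) (not_lt.1 fun hneg => hz.2 ?_)
  · have hout : Zᶜ ∈ 𝓝 z := by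
      filter_upwards [hgc.eventually (lt_mem_nhds hpos), hg.eventually_mem_iff] with y hy hyZ
      exact fun h => not_le.2 hy (hyZ.1 h)
    obtain ⟨y, hyZ, hy⟩ := mem_closure_iff_nhds.1 hz.1 _ hout
    exact hyZ hy
  · rw [mem_interior_iff_mem_nhds]
    filter_upwards [hgc.eventually (gt_mem_nhds hneg), hg.eventually_mem_iff] with y hy hyZ
    exact hyZ.2 hy.le

theorem IsDefiningFunctionAt.tendsto_slope (hg : IsDefiningFunctionAt Z z g)
    (hz : z ∈ frontier Z) (d : E n) :
    Tendsto (fun s : ℝ => s⁻¹ * g (z + s • d)) (𝓝[>] 0) (𝓝 ⟪gradient g z, d⟫_ℝ) := by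
  have h : HasDerivAt (fun s : ℝ => g (z + s • d)) ⟪gradient g z, d⟫_ℝ 0 :=
    hg.differentiableAt.hasGradientAt.hasFDerivAt.hasLineDerivAt d
  simpa [hg.apply_eq_zero hz] using h.tendsto_slope_zero_right

theorem IsDefiningFunctionAt.gradient_eq (hg : IsDefiningFunctionAt Z z g)
    (hz : z ∈ frontier Z) : gradient g z = ‖gradient g z‖ • gaussMap Z z := by
  rw [gaussMap_eq hz hg, smul_inv_smul₀ hg.norm_gradient_pos.ne']

theorem IsSmoothSet.norm_gaussMap (hZ : IsSmoothSet Z) (hz : z ∈ frontier Z) :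
    ‖gaussMap Z z‖ = 1 := by
  obtain ⟨g, hg⟩ := hZ z hz
  rw [gaussMap_eq hz hg, norm_smul, norm_inv, norm_norm,
    inv_mul_cancel₀ hg.norm_gradient_pos.ne']

theorem IsSmoothSet.eventually_mem (hZ : IsSmoothSet Z) (hz : z ∈ frontier Z)
    (hd : ⟪gaussMap Z z, d⟫_ℝ < 0) : ∀ᶠ s in 𝓝[>] (0 : ℝ), z + s • d ∈ Z := by
  obtain ⟨g, hg⟩ := hZ z hz
  have hslope : ⟪gradient g z, d⟫_ℝ < 0 := by
    rw [hg.gradient_eq hz, real_inner_smul_left]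
    exact mul_neg_of_pos_of_neg hg.norm_gradient_pos hd
  filter_upwards [(hg.tendsto_slope hz d).eventually (gt_mem_nhds hslope), self_mem_nhdsWithin,
    (tendsto_add_smul_nhdsGT_zero z d).eventually hg.eventually_mem_iff] with s hs hs0 hsZ
  exact hsZ.2 (neg_of_mul_neg_right hs (inv_nonneg.2 (le_of_lt hs0))).le

theorem IsSmoothSet.eventually_notMem (hZ : IsSmoothSet Z) (hz : z ∈ frontier Z)
    (hd : 0 < ⟪gaussMap Z z, d⟫_ℝ) : ∀ᶠ s in 𝓝[>] (0 : ℝ), z + s • d ∉ Z := by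
  obtain ⟨g, hg⟩ := hZ z hz
  have hslope : 0 < ⟪gradient g z, d⟫_ℝ := by
    rw [hg.gradient_eq hz, real_inner_smul_left]
    exact mul_pos hg.norm_gradient_pos hd
  filter_upwards [(hg.tendsto_slope hz d).eventually (lt_mem_nhds hslope), self_mem_nhdsWithin,
    (tendsto_add_smul_nhdsGT_zero z d).eventually hg.eventually_mem_iff] with s hs hs0 hsZ
  exact fun h => not_le.2 (pos_of_mul_pos_right hs (inv_nonneg.2 (le_of_lt hs0))) (hsZ.1 h)

theorem mem_argmaxSet_gaussMap (hconv : Convex ℝ Z) (hcl : IsClosed Z) (hZ : IsSmoothSet Z)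
    (hz : z ∈ frontier Z) : z ∈ argmaxSet Z (gaussMap Z z) := by
  have hzZ := hcl.frontier_subset hz
  refine ⟨hzZ, fun y hy => not_lt.1 fun hlt => ?_⟩
  have hd : 0 < ⟪gaussMap Z z, y - z⟫_ℝ := by rwa [inner_sub_right, sub_pos]
  obtain ⟨s, hsZ, hs⟩ := ((hZ.eventually_notMem hz hd).and (Ioc_mem_nhdsGT one_pos)).exists
  exact hsZ (hconv.add_smul_sub_mem hzZ hy (Ioc_subset_Icc_self hs))

theorem argmaxSet_subset_frontier (hc : c ≠ 0) : argmaxSet Z c ⊆ frontier Z := by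
  refine fun z hz => ⟨subset_closure hz.1, fun hi => ?_⟩
  have hmem := (tendsto_add_smul_nhdsGT_zero z c).eventually (mem_interior_iff_mem_nhds.1 hi)
  obtain ⟨s, hs, hs0⟩ := (hmem.and self_mem_nhdsWithin).exists
  have hle := hz.2 _ hs
  rw [inner_add_right, real_inner_smul_right] at hle
  have hpos : 0 < s * ⟪c, c⟫_ℝ := mul_pos hs0 (real_inner_self_pos.2 hc)
  linarith

theorem IsSmoothSet.gaussMap_eq_of_mem_argmaxSet (hZ : IsSmoothSet Z) (hc : ‖c‖ = 1)
    (hz : z ∈ argmaxSet Z c) : gaussMap Z z = c := by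
  have hzf := argmaxSet_subset_frontier (ne_zero_of_norm_ne_zero (by simp [hc])) hz
  have hnorm := hZ.norm_gaussMap hzf
  by_contra hne
  have hlt : ⟪gaussMap Z z, c⟫_ℝ < 1 := (inner_lt_one_iff_real_of_norm_eq_one hnorm hc).2 hne
  -- otherwise `c - gaussMap Z z` points into `Z` while increasing the linear form `c`
  have hd : ⟪gaussMap Z z, c - gaussMap Z z⟫_ℝ < 0 := by
    rw [inner_sub_right, real_inner_self_eq_norm_sq, hnorm]
    linarith
  obtain ⟨s, hs, hs0⟩ := ((hZ.eventually_mem hzf hd).and self_mem_nhdsWithin).exists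
  have hle := hz.2 _ hs
  rw [inner_add_right, real_inner_smul_right, inner_sub_right, real_inner_self_eq_norm_sq, hc,
    real_inner_comm (gaussMap Z z)] at hle
  have hpos := mul_pos (show 0 < s from hs0) (sub_pos.2 hlt)
  linarith

theorem mem_argmaxSet_iff_gaussMap_eq (hconv : Convex ℝ Z) (hcl : IsClosed Z)
    (hZ : IsSmoothSet Z) (hc : ‖c‖ = 1) :
    z ∈ argmaxSet Z c ↔ z ∈ frontier Z ∧ gaussMap Z z = c := by
  refine ⟨fun h => ⟨argmaxSet_subset_frontier (ne_zero_of_norm_ne_zero (by simp [hc])) h,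
    hZ.gaussMap_eq_of_mem_argmaxSet hc h⟩, ?_⟩
  rintro ⟨h, rfl⟩
  exact mem_argmaxSet_gaussMap hconv hcl hZ h

end GaussMap

/-! ### Faces of sets with positive curvature -/

section Faces

variable {n : ℕ} {Z : Set (E n)} {z c : E n}

theorem argmaxSet_smul {r : ℝ} (hr : 0 < r) : argmaxSet Z (r • c) = argmaxSet Z c := by
  ext z
  simp only [argmaxSet, mem_ofPred_eq, real_inner_smul_left, mul_le_mul_iff_right₀ hr]

theorem convex_argmaxSet (hconv : Convex ℝ Z) (c : E n) : Convex ℝ (argmaxSet Z c) := by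
  intro y hy z hz a b ha hb hab
  refine ⟨hconv hy.1 hz.1 ha hb hab, fun ζ hζ => ?_⟩
  calc ⟪c, ζ⟫_ℝ = a * ⟪c, ζ⟫_ℝ + b * ⟪c, ζ⟫_ℝ := by rw [← add_mul, hab, one_mul]
    _ ≤ a * ⟪c, y⟫_ℝ + b * ⟪c, z⟫_ℝ :=
      add_le_add (mul_le_mul_of_nonneg_left (hy.2 ζ hζ) ha)
        (mul_le_mul_of_nonneg_left (hz.2 ζ hζ) hb)
    _ = ⟪c, a • y + b • z⟫_ℝ := by
      rw [inner_add_right, real_inner_smul_right, real_inner_smul_right]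

theorem apply_sub_eq_zero_of_constOn_segment {X X' : Type*} [NormedAddCommGroup X]
    [NormedSpace ℝ X] [NormedAddCommGroup X'] [NormedSpace ℝ X'] {F : X → X'} {D : X →L[ℝ] X'}
    {S : Set X} {y z : X} (hD : HasFDerivWithinAt F D S y) (hS : segment ℝ y z ⊆ S)
    (hF : ∀ q ∈ segment ℝ y z, F q = F y) : D (z - y) = 0 := by
  have hseg : MapsTo (AffineMap.lineMap y z) (Icc (0 : ℝ) 1) (segment ℝ y z) := by
    rw [segment_eq_image_lineMap]
    exact mapsTo_image _ _
  have hline : HasDerivWithinAt (AffineMap.lineMap y z : ℝ → X) (z - y) (Icc 0 1) 0 :=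
    AffineMap.hasDerivWithinAt_lineMap
  have hcomp : HasDerivWithinAt (F ∘ AffineMap.lineMap y z) (D (z - y)) (Icc (0 : ℝ) 1) 0 :=
    HasFDerivWithinAt.comp_hasDerivWithinAt 0 (by simpa using hD) hline (hseg.mono_right hS)
  have hconst : HasDerivWithinAt (F ∘ AffineMap.lineMap y z) 0 (Icc (0 : ℝ) 1) 0 :=
    (hasDerivWithinAt_const (0 : ℝ) (Icc 0 1) (F y)).congr (fun s hs => hF _ (hseg hs)) (by simp)
  exact (uniqueDiffOn_Icc one_pos 0 (by simp)).eq_deriv _ hcomp hconst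

theorem subsingleton_argmaxSet_of_norm_eq_one (hconv : Convex ℝ Z) (hcl : IsClosed Z)
    (hZ : IsSmoothPositivelyCurved Z) (hc : ‖c‖ = 1) : (argmaxSet Z c).Subsingleton := by
  -- a segment in the face is tangent to the boundary, and the Gauss map is constant along it
  intro y hy z hz
  by_contra hne
  have hface : ∀ q ∈ segment ℝ y z, q ∈ frontier Z ∧ gaussMap Z q = c := fun q hq =>
    (mem_argmaxSet_iff_gaussMap_eq hconv hcl hZ.1 hc).1
      ((convex_argmaxSet hconv c).segment_subset hy hz hq)
  obtain ⟨hyf, hyc⟩ := hface y (left_mem_segment ℝ y z)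
  obtain ⟨D, hD, hpos⟩ := hZ.2 y hyf
  have htangent : ⟪gaussMap Z y, z - y⟫_ℝ = 0 := by
    rw [hyc, inner_sub_right, sub_eq_zero]
    exact le_antisymm (hy.2 z hz.1) (hz.2 y hy.1)
  have hDzero : D (z - y) = 0 := apply_sub_eq_zero_of_constOn_segment hD
    (fun q hq => (hface q hq).1) fun q hq => (hface q hq).2.trans hyc.symm
  have hlt := hpos (z - y) htangent (sub_ne_zero.2 (Ne.symm hne))
  rw [hDzero, inner_zero_right] at hlt
  exact lt_irrefl _ hlt

theorem IsCompactConvex.argmaxSet_nonempty (h : IsCompactConvex Z) (c : E n) :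
    (argmaxSet Z c).Nonempty :=
  h.compact.exists_isMaxOn (f := fun z => ⟪c, z⟫_ℝ) h.nonempty (by fun_prop)

theorem IsCompactConvex.argmaxSet_subsingleton (h : IsCompactConvex Z)
    (hZ : IsSmoothPositivelyCurved Z) (hc : c ≠ 0) : (argmaxSet Z c).Subsingleton := by
  rw [← argmaxSet_smul (inv_pos.2 (norm_pos_iff.2 hc))]
  refine subsingleton_argmaxSet_of_norm_eq_one h.convex h.compact.isClosed hZ ?_
  rw [norm_smul, norm_inv, norm_norm, inv_mul_cancel₀ (norm_ne_zero_iff.2 hc)]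

theorem IsCompactConvex.bijOn_gaussMap (h : IsCompactConvex Z)
    (hZ : IsSmoothPositivelyCurved Z) :
    BijOn (gaussMap Z) (frontier Z) (Metric.sphere 0 1) := by
  have hcl := h.compact.isClosed
  refine ⟨fun z hz => by simpa using hZ.1.norm_gaussMap hz, fun y hy z hz hyz => ?_,
    fun c hc => ?_⟩
  · refine h.argmaxSet_subsingleton hZ (ne_zero_of_norm_ne_zero (by simp [hZ.1.norm_gaussMap hy]))
      (mem_argmaxSet_gaussMap h.convex hcl hZ.1 hy) ?_
    rw [hyz]
    exact mem_argmaxSet_gaussMap h.convex hcl hZ.1 hz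
  · obtain ⟨z, hz⟩ := h.argmaxSet_nonempty c
    exact ⟨z, (mem_argmaxSet_iff_gaussMap_eq h.convex hcl hZ.1 (by simpa using hc)).1 hz⟩

theorem IsCompactConvex.argmaxSet_eq_singleton (h : IsCompactConvex Z)
    (hZ : IsSmoothPositivelyCurved Z) (hc : ‖c‖ = 1) :
    argmaxSet Z c = {invGaussMap Z c} := by
  have hmem := (h.bijOn_gaussMap hZ).surjOn (show c ∈ Metric.sphere 0 1 by simpa using hc)
  exact (h.argmaxSet_subsingleton hZ (ne_zero_of_norm_ne_zero (by simp [hc]))).eq_singleton_of_mem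
    ((mem_argmaxSet_iff_gaussMap_eq h.convex h.compact.isClosed hZ.1 hc).2
      ⟨Function.invFunOn_mem hmem, Function.invFunOn_eq hmem⟩)

theorem IsCompactConvex.eq_invGaussMap (h : IsCompactConvex Z)
    (hZ : IsSmoothPositivelyCurved Z) (hc : ‖c‖ = 1) (hz : z ∈ argmaxSet Z c) :
    z = invGaussMap Z c := by
  rwa [h.argmaxSet_eq_singleton hZ hc] at hz

end Faces

/-! ### Support functions -/

section Support

variable {n : ℕ} {Z : Set (E n)} {z c : E n}

theorem inner_le_support (h : IsCompact Z) (c : E n) (hz : z ∈ Z) : ⟪c, z⟫_ℝ ≤ support Z c :=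
  le_csSup (h.image (f := fun z => ⟪c, z⟫_ℝ) (by fun_prop)).bddAbove (mem_image_of_mem _ hz)

theorem support_le (h : Z.Nonempty) {r : ℝ} (hr : ∀ z ∈ Z, ⟪c, z⟫_ℝ ≤ r) : support Z c ≤ r :=
  csSup_le (h.image _) (forall_mem_image.2 hr)

theorem mem_argmaxSet_iff_inner_eq_support (h : IsCompact Z) :
    z ∈ argmaxSet Z c ↔ z ∈ Z ∧ ⟪c, z⟫_ℝ = support Z c :=
  and_congr_right fun hz =>
    ⟨fun hmax => le_antisymm (inner_le_support h c hz) (support_le ⟨z, hz⟩ hmax),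
      fun heq _ hζ => heq ▸ inner_le_support h c hζ⟩

theorem IsCompactConvex.mem_iff_forall_inner_le (h : IsCompactConvex Z) :
    z ∈ Z ↔ ∀ c : E n, ⟪c, z⟫_ℝ ≤ support Z c := by
  refine ⟨fun hz c => inner_le_support h.compact c hz, fun hz => by_contra fun hn => ?_⟩
  obtain ⟨l, u, hl, hu⟩ := geometric_hahn_banach_closed_point h.convex h.compact.isClosed hn
  have hdual : ∀ y, ⟪(InnerProductSpace.toDual ℝ (E n)).symm l, y⟫_ℝ = l y := fun y =>
    InnerProductSpace.toDual_symm_apply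
  have hle : l z ≤ u := hdual z ▸ (hz _).trans
    (support_le h.nonempty fun y hy => hdual y ▸ (hl y hy).le)
  exact not_lt.2 hle hu

theorem abs_support_sub_le (h : IsCompact Z) (hne : Z.Nonempty) {R : ℝ} (hR : ∀ z ∈ Z, ‖z‖ ≤ R)
    (c c' : E n) : |support Z c - support Z c'| ≤ R * ‖c - c'‖ := by
  have hle : ∀ c c' : E n, support Z c ≤ support Z c' + R * ‖c - c'‖ := fun c c' => by
    refine support_le hne fun z hz => ?_
    calc ⟪c, z⟫_ℝ = ⟪c', z⟫_ℝ + ⟪c - c', z⟫_ℝ := by rw [inner_sub_left]; ring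
      _ ≤ support Z c' + ‖c - c'‖ * ‖z‖ :=
        add_le_add (inner_le_support h c' hz) (real_inner_le_norm _ _)
      _ ≤ support Z c' + R * ‖c - c'‖ := by
        rw [mul_comm R]
        gcongr
        exact hR z hz
  rw [abs_sub_le_iff, sub_le_iff_le_add', sub_le_iff_le_add']
  exact ⟨hle c c', norm_sub_rev c c' ▸ hle c' c⟩

end Support

/-! ### Nearest points and outward normals -/

/-- The point `p` is a foot of `ξ` on `Z`, with unit outward normal `c`: it is the point of `Z`
nearest to `ξ`, and `ξ - p` is a nonnegative multiple of `c`. Interior points of `Z` have no foot;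
a boundary point is its own foot. -/
structure IsFoot {n : ℕ} (Z : Set (E n)) (ξ p c : E n) : Prop where
  norm_eq : ‖c‖ = 1
  mem_argmaxSet : p ∈ argmaxSet Z c
  sub_eq : ξ - p = ‖ξ - p‖ • c

namespace IsFoot

variable {n : ℕ} {Z : Set (E n)} {ξ p c q d : E n}

theorem mem (h : IsFoot Z ξ p c) : p ∈ Z :=
  h.mem_argmaxSet.1

theorem mem_frontier (h : IsFoot Z ξ p c) : p ∈ frontier Z :=
  argmaxSet_subset_frontier (ne_zero_of_norm_ne_zero (by simp [h.norm_eq])) h.mem_argmaxSet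

theorem inner_normal (h : IsFoot Z ξ p c) : ⟪c, ξ - p⟫_ℝ = ‖ξ - p‖ := by
  rw [h.sub_eq, real_inner_smul_right, real_inner_self_eq_norm_sq, h.norm_eq, ← h.sub_eq, one_pow,
    mul_one]

theorem inner_sub_nonpos (h : IsFoot Z ξ p c) (hq : q ∈ Z) : ⟪ξ - p, q - p⟫_ℝ ≤ 0 := by
  rw [h.sub_eq, real_inner_smul_left, inner_sub_right]
  exact mul_nonpos_of_nonneg_of_nonpos (norm_nonneg _) (sub_nonpos.2 (h.mem_argmaxSet.2 q hq))

theorem eq_of_mem (h : IsFoot Z ξ p c) (hξ : ξ ∈ Z) : ξ = p :=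
  sub_eq_zero.1 (real_inner_self_nonpos.1 (h.inner_sub_nonpos hξ))

theorem unique (h : IsFoot Z ξ p c) (h' : IsFoot Z ξ q d) : q = p := by
  have hsum : ⟪q - p, q - p⟫_ℝ = ⟪ξ - p, q - p⟫_ℝ + ⟪ξ - q, p - q⟫_ℝ := by
    rw [← neg_sub q p, inner_neg_right, ← sub_eq_add_neg, ← inner_sub_left, sub_sub_sub_cancel_left]
  refine sub_eq_zero.1 (real_inner_self_nonpos.1 ?_)
  exact hsum ▸ add_nonpos (h.inner_sub_nonpos h'.mem) (h'.inner_sub_nonpos h.mem)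

theorem normal_eq_gaussMap (h : IsFoot Z ξ p c) (hZ : IsSmoothSet Z) : c = gaussMap Z p :=
  (hZ.gaussMap_eq_of_mem_argmaxSet h.norm_eq h.mem_argmaxSet).symm

theorem normal_unique (h : IsFoot Z ξ p c) (h' : IsFoot Z ξ q d) (hZ : IsSmoothSet Z) :
    d = c := by
  rw [h.normal_eq_gaussMap hZ, h'.normal_eq_gaussMap hZ, h.unique h']

theorem self (h : IsFoot Z ξ p c) : IsFoot Z p p c :=
  ⟨h.norm_eq, h.mem_argmaxSet, by simp⟩

theorem dist_eq_infDist (h : IsFoot Z ξ p c) (hconv : Convex ℝ Z) :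
    dist ξ p = Metric.infDist ξ Z := by
  simp only [Metric.infDist_eq_iInf, dist_eq_norm]
  exact (norm_eq_iInf_iff_real_inner_le_zero hconv h.mem).2 fun q hq => h.inner_sub_nonpos hq

end IsFoot

section ExistsFoot

variable {n : ℕ} {Z : Set (E n)} {ξ p : E n}

theorem isFoot_of_dist_eq_infDist (hconv : Convex ℝ Z) (hξ : ξ ∉ Z) (hp : p ∈ Z)
    (hd : dist ξ p = Metric.infDist ξ Z) : IsFoot Z ξ p (‖ξ - p‖⁻¹ • (ξ - p)) := by
  have hne : ‖ξ - p‖ ≠ 0 := norm_ne_zero_iff.2 (sub_ne_zero.2 fun h => hξ (h ▸ hp))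
  simp only [Metric.infDist_eq_iInf, dist_eq_norm] at hd
  have hobtuse := (norm_eq_iInf_iff_real_inner_le_zero hconv hp).1 hd
  refine ⟨by rw [norm_smul, norm_inv, norm_norm, inv_mul_cancel₀ hne], ⟨hp, fun ζ hζ => ?_⟩,
    (smul_inv_smul₀ hne _).symm⟩
  rw [real_inner_smul_left, real_inner_smul_left, ← sub_nonpos, ← mul_sub, ← inner_sub_right]
  exact mul_nonpos_of_nonneg_of_nonpos (inv_nonneg.2 (norm_nonneg _)) (hobtuse ζ hζ)

theorem IsCompactConvex.exists_isFoot (h : IsCompactConvex Z) (hξ : ξ ∉ Z) :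
    ∃ p c, IsFoot Z ξ p c := by
  obtain ⟨p, hp, hd⟩ := h.compact.exists_infDist_eq_dist h.nonempty ξ
  exact ⟨p, _, isFoot_of_dist_eq_infDist h.convex hξ hp hd.symm⟩

theorem isFoot_gaussMap (hconv : Convex ℝ Z) (hcl : IsClosed Z) (hZ : IsSmoothSet Z)
    (hp : p ∈ frontier Z) : IsFoot Z p p (gaussMap Z p) :=
  ⟨hZ.norm_gaussMap hp, mem_argmaxSet_gaussMap hconv hcl hZ hp, by simp⟩

end ExistsFoot

/-! ### Continuity of selections from closed relations -/

section ClosedRelation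

variable {α β γ : Type*} [TopologicalSpace α] [TopologicalSpace β] [TopologicalSpace γ]
  {R : Set (α × γ)} {K : Set γ}

theorem continuousOn_of_isClosed_of_unique (hR : IsClosed R) (hK : IsCompact K) {T : Set β}
    {τ : β → α} (hτ : ContinuousOn τ T) {F : β → γ} (hFK : ∀ b ∈ T, F b ∈ K)
    (hFR : ∀ b ∈ T, (τ b, F b) ∈ R) (huniq : ∀ b ∈ T, ∀ y, (τ b, y) ∈ R → y = F b) :
    ContinuousOn F T := by
  intro b hb
  refine hK.tendsto_nhds_of_unique_mapClusterPt
    (eventually_mem_nhdsWithin.mono hFK) fun y _ hy => huniq b hb y ?_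
  obtain ⟨u, hu, hFu⟩ := mapClusterPt_iff_ultrafilter.1 hy
  exact hR.mem_of_tendsto (((hτ b hb).mono_left hu).prodMk_nhds hFu)
    ((eventually_mem_nhdsWithin.filter_mono hu).mono hFR)

theorem isClosed_fst_image_of_isCompact (hR : IsClosed R) (hK : IsCompact K)
    (hRK : ∀ q ∈ R, q.2 ∈ K) : IsClosed (Prod.fst '' R) := by
  have : CompactSpace K := isCompact_iff_compactSpace.1 hK
  have himage : Prod.fst '' R = Prod.fst '' ((Prod.map id (↑) : α × K → α × γ) ⁻¹' R) := by
    ext a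
    constructor
    · rintro ⟨q, hq, rfl⟩
      exact ⟨(q.1, ⟨q.2, hRK q hq⟩), hq, rfl⟩
    · rintro ⟨q, hq, rfl⟩
      exact ⟨_, hq, rfl⟩
  rw [himage]
  exact isClosedMap_fst_of_compactSpace _
    (hR.preimage (continuous_id.prodMap continuous_subtype_val))

end ClosedRelation

/-! ### Continuous families of compact convex sets -/

/-- A family of compact convex sets, indexed by `S`, whose support functions depend continuously
on the index. For compact `S` this is continuity in the Hausdorff metric. -/
structure IsContinuousFamilyOn {α : Type*} [TopologicalSpace α] {n : ℕ} (Y : α → Set (E n))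
    (S : Set α) : Prop where
  compactConvex : ∀ a ∈ S, IsCompactConvex (Y a)
  continuousOn_support : ∀ c : E n, ContinuousOn (fun a => support (Y a) c) S

namespace IsContinuousFamilyOn

variable {α β : Type*} [TopologicalSpace α] [TopologicalSpace β] {n : ℕ} {Y : α → Set (E n)}
  {S : Set α}

theorem exists_norm_le (hY : IsContinuousFamilyOn Y S) (hS : IsCompact S) :
    ∃ R : ℝ, ∀ a ∈ S, ∀ z ∈ Y a, ‖z‖ ≤ R := by
  have hbdd : ∀ c : E n, ∃ M : ℝ, ∀ a ∈ S, support (Y a) c ≤ M := fun c =>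
    (hS.image_of_continuousOn (hY.continuousOn_support c)).bddAbove.imp fun _ hM a ha =>
      hM (mem_image_of_mem _ ha)
  choose M hM using hbdd
  let e := EuclideanSpace.basisFun (Fin n) ℝ
  refine ⟨∑ i, max (M (e i)) (M (-e i)), fun a ha z hz => ?_⟩
  have hle : ∀ c, ⟪c, z⟫_ℝ ≤ M c := fun c =>
    (inner_le_support (hY.compactConvex a ha).compact c hz).trans (hM c a ha)
  rw [← e.sum_repr' z]
  refine norm_sum_le_of_le _ fun i _ => ?_
  rw [norm_smul, e.orthonormal.1 i, mul_one, Real.norm_eq_abs]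
  exact max_le_max (hle _) (inner_neg_left (𝕜 := ℝ) (e i) z ▸ hle _)

theorem continuousOn_support_prod (hY : IsContinuousFamilyOn Y S) (hS : IsCompact S) :
    ContinuousOn (fun q : α × E n => support (Y q.1) q.2) (S ×ˢ univ) := by
  obtain ⟨R, hR⟩ := hY.exists_norm_le hS
  refine continuousOn_prod_of_continuousOn_lipschitzOnWith' _ R.toNNReal (fun a ha => ?_)
    fun c _ => hY.continuousOn_support c
  refine (LipschitzWith.of_dist_le_mul fun c c' => ?_).lipschitzOnWith
  exact abs_support_sub_le (hY.compactConvex a ha).compact (hY.compactConvex a ha).nonempty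
    (fun z hz => (hR a ha z hz).trans R.le_coe_toNNReal) c c'

theorem exists_isCompact_isFoot (hY : IsContinuousFamilyOn Y S) (hS : IsCompact S) :
    ∃ K : Set (E n × E n), IsCompact K ∧
      ∀ a ∈ S, ∀ ξ p c, IsFoot (Y a) ξ p c → (p, c) ∈ K := by
  obtain ⟨R, hR⟩ := hY.exists_norm_le hS
  refine ⟨Metric.closedBall 0 R ×ˢ Metric.closedBall 0 1,
    (isCompact_closedBall _ _).prod (isCompact_closedBall _ _), fun a ha ξ p c h => ?_⟩
  simpa [h.norm_eq] using hR a ha p h.mem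

variable [T2Space α]

theorem isClosed_graph (hY : IsContinuousFamilyOn Y S) (hS : IsCompact S) :
    IsClosed {q : α × E n | q.1 ∈ S ∧ q.2 ∈ Y q.1} := by
  have hgraph : {q : α × E n | q.1 ∈ S ∧ q.2 ∈ Y q.1} =
      ⋂ c : E n, {q | q ∈ S ×ˢ univ ∧ ⟪c, q.2⟫_ℝ ≤ support (Y q.1) c} := by
    ext q
    simp only [mem_iInter, mem_ofPred_eq, mem_prod, mem_univ, and_true, forall_and,
      forall_const]
    exact and_congr_right fun hq => (hY.compactConvex _ hq).mem_iff_forall_inner_le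
  rw [hgraph]
  refine isClosed_iInter fun c => (hS.isClosed.prod isClosed_univ).isClosed_le (by fun_prop) ?_
  exact (hY.continuousOn_support c).comp continuousOn_fst fun q hq => hq.1

theorem isClosed_argmaxSet (hY : IsContinuousFamilyOn Y S) (hS : IsCompact S) :
    IsClosed {q : (α × E n) × E n | q.1.1 ∈ S ∧ q.2 ∈ argmaxSet (Y q.1.1) q.1.2} := by
  have hgraph := (hY.isClosed_graph hS).preimage
    (f := fun q : (α × E n) × E n => (q.1.1, q.2)) (by fun_prop)
  have hargmax : {q : (α × E n) × E n | q.1.1 ∈ S ∧ q.2 ∈ argmaxSet (Y q.1.1) q.1.2} =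
      {q | q ∈ (fun q : (α × E n) × E n => (q.1.1, q.2)) ⁻¹' {q | q.1 ∈ S ∧ q.2 ∈ Y q.1} ∧
        support (Y q.1.1) q.1.2 ≤ ⟪q.1.2, q.2⟫_ℝ} := by
    ext q
    simp only [mem_ofPred_eq, mem_preimage, and_assoc]
    refine and_congr_right fun hq => ?_
    have hZ := (hY.compactConvex _ hq).compact
    rw [mem_argmaxSet_iff_inner_eq_support hZ]
    exact and_congr_right fun hz => (inner_le_support hZ _ hz).ge_iff_eq.symm
  rw [hargmax]
  exact hgraph.isClosed_le ((hY.continuousOn_support_prod hS).comp continuousOn_fst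
    fun q hq => ⟨hq.1, mem_univ _⟩) (by fun_prop)

theorem isClosed_isFoot (hY : IsContinuousFamilyOn Y S) (hS : IsCompact S) :
    IsClosed {r : (α × E n) × (E n × E n) |
      r.1.1 ∈ S ∧ IsFoot (Y r.1.1) r.1.2 r.2.1 r.2.2} := by
  have hargmax := (hY.isClosed_argmaxSet hS).preimage
    (f := fun r : (α × E n) × (E n × E n) => ((r.1.1, r.2.2), r.2.1)) (by fun_prop)
  convert! (hargmax.inter (isClosed_eq (f := fun r : (α × E n) × (E n × E n) => ‖r.2.2‖)
    (g := fun _ => 1) (by fun_prop) (by fun_prop))).inter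
    (isClosed_eq (f := fun r : (α × E n) × (E n × E n) => r.1.2 - r.2.1)
      (g := fun r => ‖r.1.2 - r.2.1‖ • r.2.2) (by fun_prop) (by fun_prop)) using 1
  ext r
  exact ⟨fun ⟨hr, h⟩ => ⟨⟨⟨hr, h.mem_argmaxSet⟩, h.norm_eq⟩, h.sub_eq⟩,
    fun ⟨⟨⟨hr, hmax⟩, hc⟩, hsub⟩ => ⟨hr, hc, hmax, hsub⟩⟩

theorem isClosed_exists_isFoot (hY : IsContinuousFamilyOn Y S) (hS : IsCompact S) :
    IsClosed {q : α × E n | q.1 ∈ S ∧ ∃ p c, IsFoot (Y q.1) q.2 p c} := by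
  obtain ⟨K, hK, hfoot⟩ := hY.exists_isCompact_isFoot hS
  convert! isClosed_fst_image_of_isCompact (hY.isClosed_isFoot hS) hK
    (fun r hr => hfoot _ hr.1 _ _ _ hr.2) using 1
  ext q
  exact ⟨fun ⟨hq, p, c, h⟩ => ⟨(q, p, c), ⟨hq, h⟩, rfl⟩,
    fun ⟨r, ⟨hr, h⟩, hrq⟩ => hrq ▸ ⟨hr, _, _, h⟩⟩

variable {T : Set β} {τ : β → α}

theorem continuousOn_of_mem_argmaxSet (hY : IsContinuousFamilyOn Y S) (hS : IsCompact S)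
    (hs : ∀ a ∈ S, IsSmoothPositivelyCurved (Y a)) (hτ : ContinuousOn τ T) (hτS : MapsTo τ T S)
    {c z : β → E n} (hc : ContinuousOn c T) (hc0 : ∀ b ∈ T, c b ≠ 0)
    (hz : ∀ b ∈ T, z b ∈ argmaxSet (Y (τ b)) (c b)) : ContinuousOn z T := by
  obtain ⟨R, hR⟩ := hY.exists_norm_le hS
  refine continuousOn_of_isClosed_of_unique (hY.isClosed_argmaxSet hS)
    (isCompact_closedBall (0 : E n) R) (hτ.prodMk hc)
    (fun b hb => by simpa using hR _ (hτS hb) _ (hz b hb).1) (fun b hb => ⟨hτS hb, hz b hb⟩)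
    fun b hb y hy => ?_
  exact (hY.compactConvex _ (hτS hb)).argmaxSet_subsingleton (hs _ (hτS hb)) (hc0 b hb) hy.2
    (hz b hb)

theorem exists_continuousOn_mem_argmaxSet (hY : IsContinuousFamilyOn Y S) (hS : IsCompact S)
    (hs : ∀ a ∈ S, IsSmoothPositivelyCurved (Y a)) {A : Set α} (hAS : A ⊆ S) {p c : α → E n}
    (hc : ContinuousOn c A) (hc0 : ∀ a ∈ A, c a ≠ 0) (hp : ∀ a ∈ A, p a ∈ argmaxSet (Y a) (c a)) :
    ∃ z : α × α → E n, ContinuousOn z (A ×ˢ A) ∧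
      (∀ q ∈ A ×ˢ A, z q ∈ argmaxSet (Y q.1) (c q.2)) ∧ ∀ a ∈ A, z (a, a) = p a := by
  have hne : ∀ q ∈ A ×ˢ A, ∃ ζ, ζ ∈ argmaxSet (Y q.1) (c q.2) := fun q hq =>
    (hY.compactConvex _ (hAS hq.1)).argmaxSet_nonempty _
  choose! z hz using hne
  refine ⟨z, ?_, hz, fun a ha => ?_⟩
  · exact hY.continuousOn_of_mem_argmaxSet hS hs continuousOn_fst (fun q hq => hAS hq.1)
      (hc.comp continuousOn_snd fun q hq => hq.2) (fun q hq => hc0 _ hq.2) hz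
  · exact (hY.compactConvex a (hAS ha)).argmaxSet_subsingleton (hs a (hAS ha)) (hc0 a ha)
      (hz (a, a) ⟨ha, ha⟩) (hp a ha)

theorem continuousOn_of_isFoot (hY : IsContinuousFamilyOn Y S) (hS : IsCompact S)
    (hs : ∀ a ∈ S, IsSmoothSet (Y a)) (hτ : ContinuousOn τ T) (hτS : MapsTo τ T S)
    {x p c : β → E n} (hx : ContinuousOn x T)
    (h : ∀ b ∈ T, IsFoot (Y (τ b)) (x b) (p b) (c b)) :
    ContinuousOn (fun b => (p b, c b)) T := by
  obtain ⟨K, hK, hfoot⟩ := hY.exists_isCompact_isFoot hS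
  exact continuousOn_of_isClosed_of_unique (hY.isClosed_isFoot hS) hK (hτ.prodMk hx)
    (fun b hb => hfoot _ (hτS hb) _ _ _ (h b hb)) (fun b hb => ⟨hτS hb, h b hb⟩)
    fun b hb y hy => Prod.ext ((h b hb).unique hy.2) ((h b hb).normal_unique hy.2 (hs _ (hτS hb)))

end IsContinuousFamilyOn

theorem SatisfiesMinmaxDI.isContinuousFamilyOn {nx nu nw : ℕ} {f : E nx → E nw → E nx}
    {G : E nx → E nu →L[ℝ] E nx} {U : Set (E nu)} {W : Set (E nw)} {t₁ t₂ : ℝ}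
    {Y : ℝ → Set (E nx)} (hY : SatisfiesMinmaxDI f G U W t₁ t₂ Y) :
    IsContinuousFamilyOn Y (Icc t₁ t₂) :=
  ⟨hY.compactConvex, fun c => let ⟨_, hK⟩ := hY.lipschitz c; hK.continuousOn⟩

/-! ### Explicit feedback laws -/

theorem IsContinuousFamilyOn.exists_measurable_foot {α : Type*} [TopologicalSpace α] [T2Space α]
    [MeasurableSpace α] [OpensMeasurableSpace α] {n : ℕ} {Y : α → Set (E n)} {S : Set α}
    (hY : IsContinuousFamilyOn Y S) (hS : IsCompact S) (hs : ∀ a ∈ S, IsSmoothSet (Y a)) :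
    ∃ F : α → E n → E n × E n, Measurable (fun q : S × E n => F q.1 q.2) ∧
      ∀ a ∈ S, ∀ ξ p c, IsFoot (Y a) ξ p c → F a ξ = (p, c) := by
  classical
  let F : α → E n → E n × E n := fun a ξ =>
    if h : ∃ p c, IsFoot (Y a) ξ p c then (h.choose, h.choose_spec.choose) else 0
  have hF : ∀ {a ξ}, (∃ p c, IsFoot (Y a) ξ p c) → IsFoot (Y a) ξ (F a ξ).1 (F a ξ).2 :=
    fun h => by simpa only [F, dif_pos h] using h.choose_spec.choose_spec
  refine ⟨F, ?_, fun a ha ξ p c h => Prod.ext (h.unique (hF ⟨p, c, h⟩))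
    (h.normal_unique (hF ⟨p, c, h⟩) (hs a ha))⟩
  let D : Set (S × E n) := {q | ∃ p c, IsFoot (Y q.1) q.2 p c}
  have hD : MeasurableSet D := by
    simpa [D, preimage] using ((hY.isClosed_exists_isFoot hS).preimage
      (f := fun q : S × E n => ((q.1 : α), q.2)) (by fun_prop)).measurableSet
  have hcont : ContinuousOn (fun q : S × E n => F q.1 q.2) D :=
    hY.continuousOn_of_isFoot hS hs (continuous_subtype_val.comp continuous_fst).continuousOn
      (fun q _ => q.1.2) continuousOn_snd fun q hq => hF hq
  convert! hcont.measurable_piecewise (g := fun _ => 0) continuousOn_const hD using 1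
  ext1 q
  by_cases hq : q ∈ D
  · rw [piecewise_eq_of_mem _ _ _ hq]
  · rw [piecewise_eq_of_notMem _ _ _ hq]
    exact dif_neg hq

theorem IsCompactConvex.exists_measurable_mem_argmaxSet {n : ℕ} {Z : Set (E n)}
    (h : IsCompactConvex Z) (hZ : IsSmoothPositivelyCurved Z) :
    ∃ m : E n → E n, Measurable m ∧ ∀ c, m c ∈ argmaxSet Z c := by
  choose m hm using h.argmaxSet_nonempty
  have hconst : IsContinuousFamilyOn (fun _ : Unit => Z) univ :=
    ⟨fun _ _ => h, fun _ => continuousOn_const⟩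
  -- by strict convexity, only the direction `0` has more than one maximizer
  exact ⟨m, measurable_of_continuousOn_compl_singleton 0 <|
    hconst.continuousOn_of_mem_argmaxSet isCompact_univ (fun _ _ => hZ)
      (τ := fun _ => ()) continuousOn_const (mapsTo_univ _ _) continuousOn_id
      (fun _ hc => hc) fun c _ => hm c, hm⟩

theorem argminSet_eq {nx nu : ℕ} (G : E nx → E nu →L[ℝ] E nx) (U : Set (E nu)) (Z : Set (E nx))
    (c : E nx) : argminSet G U Z c = argmaxSet U (-(adjoint (G (invGaussMap Z c)) c)) := by
  ext ν
  simp only [argminSet, argmaxSet, mem_ofPred_eq, inner_neg_left,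
    ContinuousLinearMap.adjoint_inner_left, neg_le_neg_iff]

section Feedback

variable {nx nu : ℕ} {G : E nx → E nu →L[ℝ] E nx} {U : Set (E nu)} {t₁ t₂ : ℝ}
  {Y : ℝ → Set (E nx)}

theorem followsExplicitLaw_of_isFoot {k : E nx × E nx → E nu}
    (hY : ∀ t ∈ Icc t₁ t₂, IsCompactConvex (Y t))
    (hs : ∀ t ∈ Icc t₁ t₂, IsSmoothPositivelyCurved (Y t)) {μ : ℝ → E nx → E nu}
    (hk : ∀ p c, k (p, c) ∈ argmaxSet U (-(adjoint (G p) c)))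
    (hμ : ∀ t ∈ Icc t₁ t₂, ∀ ξ p c, IsFoot (Y t) ξ p c → μ t ξ = k (p, c)) :
    FollowsExplicitLaw G U t₁ t₂ Y μ := by
  refine ⟨fun t c => k (invGaussMap (Y t) c, c), fun t _ c _ => argminSet_eq G U _ c ▸ hk _ _,
    fun t ht ξ hξ => ?_⟩
  have hfoot := isFoot_gaussMap (hY t ht).convex (hY t ht).compact.isClosed (hs t ht).1 hξ
  dsimp only
  rw [hμ t ht _ _ _ hfoot,
    ← (hY t ht).eq_invGaussMap (hs t ht) hfoot.norm_eq hfoot.mem_argmaxSet]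

theorem lipschitzOutwards_of_isFoot {k : E nx × E nx → E nu}
    (hY : ∀ t ∈ Icc t₁ t₂, Convex ℝ (Y t)) {μ : ℝ → E nx → E nu}
    (hμ : ∀ t ∈ Icc t₁ t₂, ∀ ξ p c, IsFoot (Y t) ξ p c → μ t ξ = k (p, c)) :
    LipschitzOutwards t₁ t₂ Y μ := by
  refine ⟨0, fun t ht ξ hξ p hp hd => ?_⟩
  have hfoot := isFoot_of_dist_eq_infDist (hY t ht) hξ hp hd
  rw [hμ t ht _ _ _ hfoot, hμ t ht _ _ _ hfoot.self, sub_self, norm_zero, zero_mul]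

theorem exists_feedbackLaw (hU : IsCompactConvex U) (hUsm : IsSmoothPositivelyCurved U)
    (hG : Continuous G) (hY : IsContinuousFamilyOn Y (Icc t₁ t₂))
    (hs : ∀ t ∈ Icc t₁ t₂, IsSmoothPositivelyCurved (Y t)) :
    ∃ μ : ℝ → E nx → E nu, IsFeedbackLaw U t₁ t₂ μ ∧ FollowsExplicitLaw G U t₁ t₂ Y μ ∧
      LipschitzOutwards t₁ t₂ Y μ := by
  obtain ⟨F, hFm, hF⟩ := hY.exists_measurable_foot isCompact_Icc fun t ht => (hs t ht).1
  obtain ⟨m, hmm, hm⟩ := hU.exists_measurable_mem_argmaxSet hUsm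
  let k : E nx × E nx → E nu := fun q => m (-(adjoint (G q.1) q.2))
  have hkm : Measurable k := by
    refine hmm.comp (Continuous.measurable ?_)
    have : Continuous fun q : E nx × E nx => adjoint (G q.1) :=
      ContinuousLinearMap.adjoint.continuous.comp (hG.comp continuous_fst)
    fun_prop
  have hμ : ∀ t ∈ Icc t₁ t₂, ∀ ξ p c, IsFoot (Y t) ξ p c → k (F t ξ) = k (p, c) :=
    fun t ht ξ p c h => congrArg k (hF t ht ξ p c h)
  exact ⟨fun t ξ => k (F t ξ), ⟨fun _ _ _ => (hm _).1, hkm.comp hFm⟩,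
    followsExplicitLaw_of_isFoot hY.compactConvex hs (fun _ _ => hm _) hμ,
    lipschitzOutwards_of_isFoot (fun t ht => (hY.compactConvex t ht).convex) hμ⟩

end Feedback

/-! ### Growth along absolutely continuous trajectories -/

theorem absolutelyContinuousOnInterval_lipschitzWith_comp {X X' : Type*} [PseudoMetricSpace X]
    [PseudoMetricSpace X'] {x : ℝ → X} {a b : ℝ} (hx : AbsolutelyContinuousOnInterval x a b)
    {φ : X → X'} {K : ℝ≥0} (hφ : LipschitzWith K φ) :
    AbsolutelyContinuousOnInterval (φ ∘ x) a b := by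
  rw [absolutelyContinuousOnInterval_iff] at hx ⊢
  intro ε hε
  have hK : (0 : ℝ) < K + 1 := by positivity
  obtain ⟨δ, hδ, h⟩ := hx (ε / (K + 1)) (by positivity)
  refine ⟨δ, hδ, fun I hI hlt => ?_⟩
  calc _ ≤ ∑ i ∈ Finset.range I.1, (K + 1) * dist (x (I.2 i).1) (x (I.2 i).2) :=
        Finset.sum_le_sum fun i _ => (hφ.dist_le_mul _ _).trans <|
          mul_le_mul_of_nonneg_right (lt_add_one _).le dist_nonneg
    _ < ε := by
      rw [← Finset.mul_sum, ← lt_div_iff₀' hK]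
      exact h I hI hlt

theorem sub_le_mul_sub_of_ae_deriv_le {h : ℝ → ℝ} {a b C : ℝ} (hab : a ≤ b)
    (hh : AbsolutelyContinuousOnInterval h a b)
    (hC : ∀ᵐ t ∂(volume.restrict (Icc a b)), deriv h t ≤ C) : h b - h a ≤ C * (b - a) := by
  calc h b - h a = ∫ t in a..b, deriv h t := hh.integral_deriv_eq_sub.symm
    _ ≤ ∫ _ in a..b, C := intervalIntegral.integral_mono_ae_restrict hab
      hh.intervalIntegrable_deriv intervalIntegrable_const hC
    _ = C * (b - a) := by rw [intervalIntegral.integral_const, smul_eq_mul, mul_comm]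

theorem SatisfiesMinmaxDI.inner_sub_support_le {nx nu nw : ℕ} {f : E nx → E nw → E nx}
    {G : E nx → E nu →L[ℝ] E nx} {U : Set (E nu)} {W : Set (E nw)} {t₁ t₂ : ℝ}
    {Y : ℝ → Set (E nx)} (hY : SatisfiesMinmaxDI f G U W t₁ t₂ Y) {τ t : ℝ} (hτ : t₁ ≤ τ)
    (hτt : τ ≤ t) (ht : t ≤ t₂) {x v : ℝ → E nx} (hx : AbsolutelyContinuousOnInterval x τ t)
    (hv : ∀ᵐ σ ∂(volume.restrict (Icc τ t)), HasDerivAt x (v σ) σ) {c : E nx} {M : ℝ}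
    (hM : ∀ σ ∈ Icc τ t, ⟪c, v σ⟫_ℝ - minmaxRate f G U W c (Y σ) ≤ M) :
    (⟪c, x t⟫_ℝ - support (Y t) c) - (⟪c, x τ⟫_ℝ - support (Y τ) c) ≤ M * (t - τ) := by
  obtain ⟨K, hK⟩ := hY.lipschitz c
  have hsub : Icc τ t ⊆ Icc t₁ t₂ := Icc_subset_Icc hτ ht
  have hsupport : AbsolutelyContinuousOnInterval (fun σ => support (Y σ) c) τ t :=
    LipschitzOnWith.absolutelyContinuousOnInterval (hK.mono (by rwa [uIcc_of_le hτt]))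
  have hinner : AbsolutelyContinuousOnInterval (fun σ => ⟪c, x σ⟫_ℝ) τ t :=
    absolutelyContinuousOnInterval_lipschitzWith_comp hx (innerSL ℝ c).lipschitz
  refine sub_le_mul_sub_of_ae_deriv_le hτt (hinner.sub hsupport) ?_
  have hdiff := hsupport.ae_differentiableAt
  rw [uIcc_of_le hτt, ← ae_restrict_iff' measurableSet_Icc] at hdiff
  filter_upwards [hv, hdiff, ae_restrict_of_ae_restrict_of_subset hsub (hY.inequality c),
    ae_restrict_mem measurableSet_Icc] with σ hx' hV' hrate hσ
  have hinner' : HasDerivAt (fun σ => ⟪c, x σ⟫_ℝ) ⟪c, v σ⟫_ℝ σ := by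
    simpa using (hasDerivAt_const σ c).inner ℝ hx'
  rw [(hinner'.sub hV'.hasDerivAt).deriv]
  exact (sub_le_sub_left hrate _).trans (hM σ hσ)

theorem IsFoot.inner_sub_support {n : ℕ} {Z : Set (E n)} {ξ p c : E n} (h : IsFoot Z ξ p c)
    (hZ : IsCompact Z) : ⟪c, ξ⟫_ℝ - support Z c = ‖ξ - p‖ := by
  rw [← ((mem_argmaxSet_iff_inner_eq_support hZ).1 h.mem_argmaxSet).2, ← inner_sub_right,
    h.inner_normal]

theorem inner_sub_support_le_norm_sub {n : ℕ} {Z : Set (E n)} {c p : E n} (hZ : IsCompact Z)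
    (hc : ‖c‖ = 1) (hp : p ∈ Z) (ξ : E n) : ⟪c, ξ⟫_ℝ - support Z c ≤ ‖ξ - p‖ := by
  calc ⟪c, ξ⟫_ℝ - support Z c ≤ ⟪c, ξ - p⟫_ℝ := by
        rw [inner_sub_right]
        exact sub_le_sub_left (inner_le_support hZ c hp) _
    _ ≤ ‖ξ - p‖ := by simpa [hc] using real_inner_le_norm c (ξ - p)

/-! ### Velocity estimates -/

section VelocityEstimates

variable {nx nu nw : ℕ} {f : E nx → E nw → E nx} {G : E nx → E nu →L[ℝ] E nx} {U : Set (E nu)}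
  {W : Set (E nw)} {N Z : Set (E nx)}

theorem bddAbove_inner_velocitySet (hf : Continuous (Function.uncurry f)) (hG : Continuous G)
    (hW : IsCompact W) (hZ : IsCompact Z) (ν : E nu) (c : E nx) :
    BddAbove ((fun z => ⟪c, z⟫_ℝ) '' velocitySet f G W ν c Z) := by
  have hcont : Continuous fun q : E nx × E nw => ⟪c, Function.uncurry f q + G q.1 ν⟫_ℝ := by
    fun_prop
  refine ((hZ.prod hW).image hcont).bddAbove.mono ?_
  rintro _ ⟨_, ⟨ξ, hξ, b, hb, -, rfl⟩, rfl⟩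
  exact ⟨(ξ, b), ⟨hξ, hb⟩, rfl⟩

theorem inner_sub_support_le_minmaxRate (hf : Continuous (Function.uncurry f)) (hG : Continuous G)
    (hU : IsCompact U) (hU₀ : U.Nonempty) (hW : IsCompact W) (hZ : IsCompact Z) {c ξ : E nx}
    (hξ : ξ ∈ argmaxSet Z c) {b : E nw} (hb : b ∈ W) :
    ⟪c, f ξ b⟫_ℝ - support U (-(adjoint (G ξ) c)) ≤ minmaxRate f G U W c Z := by
  refine le_csInf (hU₀.image _) (forall_mem_image.2 fun ν hν => ?_)
  have hface := (mem_argmaxSet_iff_inner_eq_support hZ).1 hξ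
  have hν' := inner_le_support hU (-(adjoint (G ξ) c)) hν
  rw [inner_neg_left, ContinuousLinearMap.adjoint_inner_left] at hν'
  calc ⟪c, f ξ b⟫_ℝ - support U (-(adjoint (G ξ) c)) ≤ ⟪c, f ξ b + G ξ ν⟫_ℝ := by
        rw [inner_add_right]
        linarith
    _ ≤ support (velocitySet f G W ν c Z) c :=
      le_csSup (bddAbove_inner_velocitySet hf hG hW hZ ν c)
        (mem_image_of_mem _ ⟨ξ, hξ.1, b, hb, hface.2, rfl⟩)

/-- `C` is a common bound, over the set `N` of states, for the Lipschitz constants in the state of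
the drift `f` and of the input matrix `G`, for the norm of `G`, and for the controls in `U`. -/
structure IsSystemBound (f : E nx → E nw → E nx) (G : E nx → E nu →L[ℝ] E nx) (U : Set (E nu))
    (W : Set (E nw)) (N : Set (E nx)) (C : ℝ≥0) : Prop where
  lipschitzOnWith_drift : ∀ b ∈ W, LipschitzOnWith C (fun ξ => f ξ b) N
  lipschitzOnWith_input : LipschitzOnWith C G N
  norm_input_le : ∀ ξ ∈ N, ‖G ξ‖ ≤ C
  norm_control_le : ∀ ν ∈ U, ‖ν‖ ≤ C

theorem LocallyLipschitzInState.exists_nhds_lipschitzOnWith (hfL : LocallyLipschitzInState f)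
    (hW : IsCompact W) (x₀ : E nx) :
    ∃ K : ℝ≥0, ∃ A ∈ 𝓝 x₀, ∀ b ∈ W, LipschitzOnWith K (fun x => f x b) A := by
  refine hW.induction_on (p := fun S => ∃ K : ℝ≥0, ∃ A ∈ 𝓝 x₀, ∀ b ∈ S,
    LipschitzOnWith K (fun x => f x b) A) ⟨0, univ, univ_mem, by simp⟩ ?_ ?_ ?_
  · rintro S S' hSS' ⟨K, A, hA, h⟩
    exact ⟨K, A, hA, fun b hb => h b (hSS' hb)⟩
  · rintro S S' ⟨K, A, hA, h⟩ ⟨K', A', hA', h'⟩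
    refine ⟨max K K', A ∩ A', inter_mem hA hA', fun b hb => ?_⟩
    rcases hb with hb | hb
    · exact ((h b hb).weaken (le_max_left _ _)).mono inter_subset_left
    · exact ((h' b hb).weaken (le_max_right _ _)).mono inter_subset_right
  · intro b _
    obtain ⟨K, A, hA, B, hB, h⟩ := hfL x₀ b
    exact ⟨B, mem_nhdsWithin_of_mem_nhds hB, K, A, hA, h⟩

theorem LocallyLipschitzInState.exists_lipschitzOnWith (hfL : LocallyLipschitzInState f)
    (hf : Continuous (Function.uncurry f)) (hW : IsCompact W) (hN : IsCompact N) :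
    ∃ K : ℝ≥0, ∀ b ∈ W, LipschitzOnWith K (fun x => f x b) N := by
  have : CompactSpace W := isCompact_iff_compactSpace.1 hW
  -- Lipschitz continuity uniformly in `b ∈ W` is that of `Φ` in the supremum norm on `C(W, E nx)`.
  let Φ : E nx → C(W, E nx) := fun x => ⟨fun b => f x b, by fun_prop⟩
  have hΦ : LocallyLipschitzOn N Φ := fun x₀ _ => by
    obtain ⟨K, A, hA, hK⟩ := hfL.exists_nhds_lipschitzOnWith hW x₀
    refine ⟨K, A, mem_nhdsWithin_of_mem_nhds hA, LipschitzOnWith.of_dist_le_mul fun x hx y hy => ?_⟩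
    exact (ContinuousMap.dist_le (by positivity)).2 fun b => (hK b b.2).dist_le_mul x hx y hy
  obtain ⟨K, hK⟩ := hΦ.exists_lipschitzOnWith_of_compact hN
  exact ⟨K, fun b hb => LipschitzOnWith.of_dist_le_mul fun x hx y hy =>
    (ContinuousMap.dist_apply_le_dist (⟨b, hb⟩ : W)).trans (hK.dist_le_mul x hx y hy)⟩

theorem exists_isSystemBound (hf : Continuous (Function.uncurry f))
    (hfL : LocallyLipschitzInState f) (hG : LocallyLipschitz G) (hU : IsCompact U)
    (hW : IsCompact W) (hN : IsCompact N) : ∃ C, IsSystemBound f G U W N C := by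
  obtain ⟨Cf, hCf⟩ := hfL.exists_lipschitzOnWith hf hW hN
  obtain ⟨CL, hCL⟩ := (hG.locallyLipschitzOn (s := N)).exists_lipschitzOnWith_of_compact hN
  obtain ⟨CG, hCG⟩ := hN.exists_bound_of_continuousOn hG.continuous.continuousOn
  obtain ⟨CU, hCU⟩ := hU.isBounded.exists_norm_le
  refine ⟨Cf ⊔ CL ⊔ CG.toNNReal ⊔ CU.toNNReal, fun b hb => (hCf b hb).weaken (by simp),
    hCL.weaken (by simp), fun ξ hξ => ?_, fun ν hν => ?_⟩
  · exact (hCG ξ hξ).trans ((Real.le_coe_toNNReal CG).trans (by simp))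
  · exact (hCU ν hν).trans ((Real.le_coe_toNNReal CU).trans (by simp))

namespace IsSystemBound

variable {C : ℝ≥0}

theorem norm_adjoint_sub_le (h : IsSystemBound f G U W N C) {ξ ξ' c c' : E nx} (hξ : ξ ∈ N)
    (hξ' : ξ' ∈ N) (hc : ‖c‖ = 1) :
    ‖adjoint (G ξ) c - adjoint (G ξ') c'‖ ≤ C * (‖ξ - ξ'‖ + ‖c - c'‖) := by
  calc ‖adjoint (G ξ) c - adjoint (G ξ') c'‖
      = ‖adjoint (G ξ - G ξ') c + adjoint (G ξ') (c - c')‖ := by simp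
    _ ≤ ‖adjoint (G ξ - G ξ') c‖ + ‖adjoint (G ξ') (c - c')‖ := norm_add_le _ _
    _ ≤ ‖G ξ - G ξ'‖ + ‖G ξ'‖ * ‖c - c'‖ := by
      refine add_le_add ?_ ?_
      · exact ((adjoint (G ξ - G ξ')).le_opNorm c).trans_eq
          (by rw [hc, mul_one, LinearIsometryEquiv.norm_map])
      · simpa using (adjoint (G ξ')).le_opNorm (c - c')
    _ ≤ C * ‖ξ - ξ'‖ + C * ‖c - c'‖ := by
      gcongr
      · exact h.lipschitzOnWith_input.norm_sub_le hξ hξ'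
      · exact h.norm_input_le ξ' hξ'
    _ = C * (‖ξ - ξ'‖ + ‖c - c'‖) := by ring

theorem inner_adjoint_add_support_le (h : IsSystemBound f G U W N C) (hU : IsCompact U)
    {x p ξ c c' : E nx} (hx : x ∈ N) (hp : p ∈ N) (hξ : ξ ∈ N) (hc : ‖c‖ = 1) (hc' : ‖c'‖ = 1)
    {u v : E nu} (hu : u ∈ U) (hv : v ∈ argmaxSet U (-(adjoint (G p) c'))) :
    ⟪adjoint (G x) c, u⟫_ℝ + support U (-(adjoint (G ξ) c)) ≤
      C * (C * (‖x - p‖ + ‖c - c'‖)) + C * ‖u - v‖ + C * (C * (‖p - ξ‖ + ‖c - c'‖)) := by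
  set A := adjoint (G p) c'
  have hinput : ⟪adjoint (G x) c - A, u⟫_ℝ ≤ C * (C * (‖x - p‖ + ‖c - c'‖)) := by
    rw [mul_comm (C : ℝ)]
    exact (real_inner_le_norm _ _).trans <| mul_le_mul (h.norm_adjoint_sub_le hx hp hc)
      (h.norm_control_le u hu) (norm_nonneg _) (by positivity)
  have hcontrol : ⟪A, u - v⟫_ℝ ≤ C * ‖u - v‖ := by
    refine (real_inner_le_norm _ _).trans (mul_le_mul_of_nonneg_right ?_ (norm_nonneg _))
    simpa [hc'] using ((adjoint (G p)).le_opNorm c').trans (mul_le_mul_of_nonneg_right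
      (by simpa using h.norm_input_le p hp) (norm_nonneg _))
  have hsupport : support U (-(adjoint (G ξ) c)) - support U (-A) ≤
      C * (C * (‖p - ξ‖ + ‖c - c'‖)) := by
    refine (le_abs_self _).trans ((abs_support_sub_le hU ⟨u, hu⟩ h.norm_control_le _ _).trans ?_)
    gcongr
    rw [neg_sub_neg, norm_sub_rev, norm_sub_rev p]
    exact h.norm_adjoint_sub_le hξ hp hc
  have hmin : ⟪-A, v⟫_ℝ = support U (-A) := ((mem_argmaxSet_iff_inner_eq_support hU).1 hv).2
  rw [inner_neg_left] at hmin
  rw [inner_sub_left] at hinput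
  rw [inner_sub_right] at hcontrol
  linarith

theorem inner_velocity_sub_minmaxRate_le (h : IsSystemBound f G U W N C)
    (hf : Continuous (Function.uncurry f)) (hG : Continuous G) (hU : IsCompact U)
    (hW : IsCompact W) (hZ : IsCompact Z) {x p ξ c c' : E nx} (hx : x ∈ N) (hp : p ∈ N)
    (hξN : ξ ∈ N) (hc : ‖c‖ = 1) (hc' : ‖c'‖ = 1) (hξ : ξ ∈ argmaxSet Z c) {b : E nw} (hb : b ∈ W)
    {u v : E nu} (hu : u ∈ U) (hv : v ∈ argmaxSet U (-(adjoint (G p) c'))) {L : ℝ≥0}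
    (huv : ‖u - v‖ ≤ L * ‖x - p‖) :
    ⟪c, f x b + G x u⟫_ℝ - minmaxRate f G U W c Z ≤
      (C + 2 * C ^ 2 + C * L : ℝ≥0) * (‖x - p‖ + ‖p - ξ‖ + ‖c - c'‖) := by
  have hrate := inner_sub_support_le_minmaxRate hf hG hU ⟨u, hu⟩ hW hZ hξ hb
  have hinput := h.inner_adjoint_add_support_le hU hx hp hξN hc hc' hu hv
  have hdrift : ⟪c, f x b - f ξ b⟫_ℝ ≤ C * (‖x - p‖ + ‖p - ξ‖) := by
    calc ⟪c, f x b - f ξ b⟫_ℝ ≤ ‖f x b - f ξ b‖ := by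
          simpa [hc] using real_inner_le_norm c (f x b - f ξ b)
      _ ≤ C * ‖x - ξ‖ := (h.lipschitzOnWith_drift b hb).norm_sub_le hx hξN
      _ ≤ C * (‖x - p‖ + ‖p - ξ‖) := by
        gcongr
        exact norm_sub_le_norm_sub_add_norm_sub x p ξ
  have hlaw : C * ‖u - v‖ ≤ C * (L * ‖x - p‖) := by gcongr
  rw [ContinuousLinearMap.adjoint_inner_left] at hinput
  rw [inner_sub_right] at hdrift
  rw [inner_add_right]
  have hspare : 0 ≤ C * (‖c - c'‖ + L * (‖p - ξ‖ + ‖c - c'‖)) + C ^ 2 * (‖x - p‖ + ‖p - ξ‖) := by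
    positivity
  push_cast
  linarith

end IsSystemBound

end VelocityEstimates

/-! ### Invariance of the tube -/

theorem nonpos_of_forall_sub_le {d : ℝ → ℝ} {e : ℝ × ℝ → ℝ} {a b Λ : ℝ}
    (hd : ContinuousOn d (Icc a b)) (hda : d a ≤ 0) (he : ContinuousOn e (Icc a b ×ˢ Icc a b))
    (hed : ∀ t ∈ Icc a b, e (t, t) = Λ * d t)
    (hgrow : ∀ t₀ ∈ Icc a b, ∀ t ∈ Icc a b, t₀ ≤ t → ∀ M, (∀ σ ∈ Icc t₀ t, e (σ, t) ≤ M) →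
      d t - d t₀ ≤ M * (t - t₀)) : ∀ t ∈ Icc a b, d t ≤ 0 := by
  have hgronwall := le_gronwallBound_of_liminf_deriv_right_le (f' := fun t => Λ * d t) (ε := 0) hd
    (fun t₀ ht₀ r hr => ?_) hda (fun t _ => (add_zero _).ge)
  · simpa only [gronwallBound_ε0_δ0] using hgronwall
  -- Near `t₀` the growth rate is at most some `M` between `Λ * d t₀ = e (t₀, t₀)` and `r`.
  obtain ⟨M, hM, hMr⟩ := exists_between hr
  have ht₀' := Ico_subset_Icc_self ht₀
  have hright : 𝓝[≥] t₀ ≤ 𝓝[Icc a b] t₀ := nhdsWithin_le_iff.2 (Icc_mem_nhdsGE_of_mem ht₀)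
  have hsmall : ∀ᶠ q in 𝓝[≥] t₀ ×ˢ 𝓝[≥] t₀, e q < M := by
    have htendsto := he (t₀, t₀) ⟨ht₀', ht₀'⟩
    rw [ContinuousWithinAt, nhdsWithin_prod_eq, hed t₀ ht₀'] at htendsto
    exact (htendsto.eventually (gt_mem_nhds hM)).filter_mono (prod_mono hright hright)
  obtain ⟨S, hS, hSM⟩ := (eventually_prod_self_iff (r := fun σ t => e (σ, t) < M)).1 hsmall
  obtain ⟨t', ht', hsub⟩ := mem_nhdsGE_iff_exists_Icc_subset.1
    (inter_mem hS (hright self_mem_nhdsWithin))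
  refine Eventually.frequently ?_
  filter_upwards [Ioc_mem_nhdsGT ht'] with t ht
  have hslope := hgrow t₀ ht₀' t (hsub (Ioc_subset_Icc_self ht)).2 ht.1.le M fun σ hσ =>
    (hSM σ (hsub ⟨hσ.1, hσ.2.trans ht.2⟩).1 t (hsub (Ioc_subset_Icc_self ht)).1).le
  exact ((inv_mul_le_iff₀' (sub_pos.2 ht.1)).2 hslope).trans_lt hMr

theorem IsContinuousFamilyOn.exists_mem_Ico_forall_mem_Ioc_notMem {n : ℕ} {Y : ℝ → Set (E n)}
    {S : Set ℝ} (hY : IsContinuousFamilyOn Y S) (hS : IsCompact S) {s s' : ℝ} (hss : s ≤ s')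
    (hsub : Icc s s' ⊆ S) {x : ℝ → E n} (hx : ContinuousOn x (Icc s s')) (hs : x s ∈ Y s)
    (hs' : x s' ∉ Y s') : ∃ a ∈ Ico s s', x a ∈ Y a ∧ ∀ t ∈ Ioc a s', x t ∉ Y t := by
  have hclosed : IsClosed (Icc s s' ∩ {t | x t ∈ Y t}) := by
    convert! (continuousOn_id.prodMk hx).preimage_isClosed_of_isClosed isClosed_Icc
      (hY.isClosed_graph hS) using 1
    ext t
    exact and_congr_right fun ht => (and_iff_right (hsub ht)).symm
  obtain ⟨a, ⟨ha, hxa⟩, hmax⟩ := (isCompact_Icc.of_isClosed_subset hclosed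
    inter_subset_left).exists_isGreatest ⟨s, left_mem_Icc.2 hss, hs⟩
  exact ⟨a, ⟨ha.1, ha.2.lt_of_ne fun h => hs' (h ▸ hxa)⟩, hxa,
    fun t ht hxt => ht.1.not_ge (hmax ⟨⟨ha.1.trans ht.1.le, ht.2⟩, hxt⟩)⟩

theorem IsContinuousFamilyOn.exists_isFoot_of_mem_Icc {n : ℕ} {Y : ℝ → Set (E n)} {S : Set ℝ}
    (hY : IsContinuousFamilyOn Y S) (hS : IsCompact S) {a b : ℝ} (hab : a < b)
    (habS : Icc a b ⊆ S) {x : ℝ → E n} (hx : ContinuousOn x (Icc a b))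
    (hout : ∀ t ∈ Ioc a b, x t ∉ Y t) : ∀ t ∈ Icc a b, ∃ p c, IsFoot (Y t) (x t) p c := by
  have hclosed : IsClosed (Icc a b ∩ (fun t => (t, x t)) ⁻¹'
      {q | q.1 ∈ S ∧ ∃ p c, IsFoot (Y q.1) q.2 p c}) :=
    (continuousOn_id.prodMk hx).preimage_isClosed_of_isClosed isClosed_Icc
      (hY.isClosed_exists_isFoot hS)
  have hsub := hclosed.closure_subset_iff.2 fun t (ht : t ∈ Ioc a b) =>
    have htS := habS (Ioc_subset_Icc_self ht)
    ⟨Ioc_subset_Icc_self ht, htS, (hY.compactConvex t htS).exists_isFoot (hout t ht)⟩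
  rw [closure_Ioc hab.ne] at hsub
  exact fun t ht => (hsub ht).2.2

section Invariance

variable {nx nu nw : ℕ} {f : E nx → E nw → E nx} {G : E nx → E nu →L[ℝ] E nx} {U : Set (E nu)}
  {W : Set (E nw)} {t₁ t₂ : ℝ} {Y : ℝ → Set (E nx)} {μ : ℝ → E nx → E nu}

theorem FollowsExplicitLaw.mem_argmaxSet_of_isFoot (hμ : FollowsExplicitLaw G U t₁ t₂ Y μ) {t : ℝ}
    (ht : t ∈ Icc t₁ t₂) (hY : IsCompactConvex (Y t)) (hs : IsSmoothPositivelyCurved (Y t))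
    {ξ p c : E nx} (h : IsFoot (Y t) ξ p c) : μ t p ∈ argmaxSet U (-(adjoint (G p) c)) := by
  obtain ⟨μs, hmin, hμs⟩ := hμ
  have hargmin := hmin t ht c (by simpa using h.norm_eq)
  rwa [argminSet_eq, ← hY.eq_invGaussMap hs h.norm_eq h.mem_argmaxSet,
    h.normal_eq_gaussMap hs.1, ← hμs t ht p h.mem_frontier, ← h.normal_eq_gaussMap hs.1]
    at hargmin

theorem LipschitzOutwards.exists_norm_sub_le (hμ : LipschitzOutwards t₁ t₂ Y μ)
    (hY : ∀ t ∈ Icc t₁ t₂, Convex ℝ (Y t)) :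
    ∃ L : ℝ≥0, ∀ t ∈ Icc t₁ t₂, ∀ ξ p c, IsFoot (Y t) ξ p c →
      ‖μ t ξ - μ t p‖ ≤ L * ‖ξ - p‖ := by
  obtain ⟨L, hL⟩ := hμ
  refine ⟨L.toNNReal, fun t ht ξ p c h => ?_⟩
  by_cases hξ : ξ ∈ Y t
  · simp [h.eq_of_mem hξ]
  · rw [← dist_eq_norm ξ]
    exact (hL t ht ξ hξ p h.mem (h.dist_eq_infDist (hY t ht))).trans
      (mul_le_mul_of_nonneg_right (Real.le_coe_toNNReal L) dist_nonneg)

theorem SatisfiesMinmaxDI.norm_sub_foot_sub_le (hY : SatisfiesMinmaxDI f G U W t₁ t₂ Y) {τ t : ℝ}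
    (hτ : t₁ ≤ τ) (hτt : τ ≤ t) (ht : t ≤ t₂) {x v : ℝ → E nx}
    (hx : AbsolutelyContinuousOnInterval x τ t)
    (hv : ∀ᵐ σ ∂(volume.restrict (Icc τ t)), HasDerivAt x (v σ) σ) {p p₀ c : E nx} {M : ℝ}
    (hp : IsFoot (Y t) (x t) p c) (hp₀ : p₀ ∈ Y τ)
    (hM : ∀ σ ∈ Icc τ t, ⟪c, v σ⟫_ℝ - minmaxRate f G U W c (Y σ) ≤ M) :
    ‖x t - p‖ - ‖x τ - p₀‖ ≤ M * (t - τ) := by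
  have hcompact : ∀ σ ∈ Icc τ t, IsCompact (Y σ) := fun σ hσ =>
    (hY.compactConvex σ ⟨hτ.trans hσ.1, hσ.2.trans ht⟩).compact
  refine (sub_le_sub ?_ ?_).trans (hY.inner_sub_support_le hτ hτt ht hx hv hM)
  · exact (hp.inner_sub_support (hcompact t (right_mem_Icc.2 hτt))).ge
  · exact inner_sub_support_le_norm_sub (hcompact τ (left_mem_Icc.2 hτt)) hp.norm_eq hp₀ (x τ)

theorem SatisfiesMinmaxDI.mem_of_forall_isFoot (hY : SatisfiesMinmaxDI f G U W t₁ t₂ Y)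
    (hs : ∀ t ∈ Icc t₁ t₂, IsSmoothPositivelyCurved (Y t)) {a b : ℝ} (hab : a ≤ b) (ha : t₁ ≤ a)
    (hb : b ≤ t₂) {x v p c : ℝ → E nx} (hx : AbsolutelyContinuousOnInterval x a b)
    (hv : ∀ᵐ σ ∂(volume.restrict (Icc a b)), HasDerivAt x (v σ) σ) (hxa : x a ∈ Y a)
    (hfoot : ∀ t ∈ Icc a b, IsFoot (Y t) (x t) (p t) (c t)) {Λ : ℝ}
    (hvel : ∀ σ ∈ Icc a b, ∀ e ξ, ‖e‖ = 1 → ξ ∈ argmaxSet (Y σ) e →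
      ⟪e, v σ⟫_ℝ - minmaxRate f G U W e (Y σ) ≤ Λ * (‖x σ - p σ‖ + ‖p σ - ξ‖ + ‖e - c σ‖)) :
    ∀ t ∈ Icc a b, x t ∈ Y t := by
  have hsub : Icc a b ⊆ Icc t₁ t₂ := Icc_subset_Icc ha hb
  have hfam := hY.isContinuousFamilyOn
  have hxc : ContinuousOn x (Icc a b) := by simpa only [uIcc_of_le hab] using hx.continuousOn
  have hfootc := hfam.continuousOn_of_isFoot isCompact_Icc (fun t ht => (hs t ht).1)
    continuousOn_id hsub hxc hfoot
  have hpc : ContinuousOn p (Icc a b) := hfootc.fst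
  have hcc : ContinuousOn c (Icc a b) := hfootc.snd
  have hfst : MapsTo Prod.fst (Icc a b ×ˢ Icc a b) (Icc a b) := fun q hq => hq.1
  have hsnd : MapsTo Prod.snd (Icc a b ×ˢ Icc a b) (Icc a b) := fun q hq => hq.2
  -- `z (σ, t)` is the maximizer at time `σ` in the direction normal at the foot at time `t`.
  obtain ⟨z, hzc, hzmem, hzdiag⟩ := hfam.exists_continuousOn_mem_argmaxSet isCompact_Icc hs hsub
    hcc (fun t ht => ne_zero_of_norm_ne_zero (by simp [(hfoot t ht).norm_eq]))
    fun t ht => (hfoot t ht).mem_argmaxSet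
  have hdist : ContinuousOn (fun t => ‖x t - p t‖) (Icc a b) := (hxc.sub hpc).norm
  let rate : ℝ × ℝ → ℝ := fun q => Λ * (‖x q.1 - p q.1‖ + ‖p q.1 - z q‖ + ‖c q.2 - c q.1‖)
  have hrate : ContinuousOn rate (Icc a b ×ˢ Icc a b) :=
    (((hdist.comp continuousOn_fst hfst).add ((hpc.comp continuousOn_fst hfst).sub hzc).norm).add
      ((hcc.comp continuousOn_snd hsnd).sub
        (hcc.comp continuousOn_fst hfst)).norm).const_mul Λ
  have hdiag : ∀ t ∈ Icc a b, rate (t, t) = Λ * ‖x t - p t‖ := fun t ht => by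
    simp [rate, hzdiag t ht]
  have hgrow : ∀ t₀ ∈ Icc a b, ∀ t ∈ Icc a b, t₀ ≤ t → ∀ M, (∀ σ ∈ Icc t₀ t, rate (σ, t) ≤ M) →
      ‖x t - p t‖ - ‖x t₀ - p t₀‖ ≤ M * (t - t₀) := fun t₀ ht₀ t ht htt M hM => by
    have htsub : Icc t₀ t ⊆ Icc a b := Icc_subset_Icc ht₀.1 ht.2
    have hx' : AbsolutelyContinuousOnInterval x t₀ t :=
      hx.mono (by rwa [uIcc_of_le htt, uIcc_of_le hab])
    exact hY.norm_sub_foot_sub_le (ha.trans ht₀.1) htt (ht.2.trans hb) hx'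
      (ae_restrict_of_ae_restrict_of_subset htsub hv) (hfoot t ht) (hfoot t₀ ht₀).mem fun σ hσ =>
        (hvel σ (htsub hσ) _ _ (hfoot t ht).norm_eq (hzmem (σ, t) ⟨htsub hσ, ht⟩)).trans (hM σ hσ)
  intro t ht
  have hdist₀ := norm_sub_eq_zero_iff.2 ((hfoot a (left_mem_Icc.2 hab)).eq_of_mem hxa)
  have hnonpos := nonpos_of_forall_sub_le hdist hdist₀.le hrate hdiag hgrow t ht
  exact sub_eq_zero.1 (norm_le_zero_iff.1 hnonpos) ▸ (hfoot t ht).mem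

theorem keepsInTube_of_followsExplicitLaw (hU : IsCompact U) (hW : IsCompact W)
    (hf : Continuous (Function.uncurry f)) (hfL : LocallyLipschitzInState f)
    (hG : LocallyLipschitz G)
    (hY : SatisfiesMinmaxDI f G U W t₁ t₂ Y)
    (hs : ∀ t ∈ Icc t₁ t₂, IsSmoothPositivelyCurved (Y t)) (hμU : ∀ t ∈ Icc t₁ t₂, ∀ ξ, μ t ξ ∈ U)
    (hμ : FollowsExplicitLaw G U t₁ t₂ Y μ) (hμL : LipschitzOutwards t₁ t₂ Y μ) :
    KeepsInTube f G W t₁ t₂ Y μ := by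
  intro s s' hs₁ hss hs₂ w x hw ⟨hx, hx'⟩ hxs
  by_contra hxs'
  have hfam := hY.isContinuousFamilyOn
  have hxc : ContinuousOn x (Icc s s') := by simpa only [uIcc_of_le hss] using hx.continuousOn
  have hsub : Icc s s' ⊆ Icc t₁ t₂ := Icc_subset_Icc hs₁ hs₂
  obtain ⟨a, ha, hxa, hout⟩ := hfam.exists_mem_Ico_forall_mem_Ioc_notMem isCompact_Icc hss hsub
    hxc hxs hxs'
  have hasub : Icc a s' ⊆ Icc s s' := Icc_subset_Icc_left ha.1
  choose! p c hfoot using hfam.exists_isFoot_of_mem_Icc isCompact_Icc ha.2 (hasub.trans hsub)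
    (hxc.mono hasub) hout
  obtain ⟨R, hR⟩ := hfam.exists_norm_le isCompact_Icc
  let N : Set (E nx) := x '' Icc s s' ∪ Metric.closedBall 0 R
  have hYN : ∀ t ∈ Icc t₁ t₂, Y t ⊆ N := fun t ht z hz =>
    Or.inr (mem_closedBall_zero_iff.2 (hR t ht z hz))
  obtain ⟨C, hC⟩ := exists_isSystemBound hf hfL hG hU hW
    ((isCompact_Icc.image_of_continuousOn hxc).union (isCompact_closedBall 0 R) : IsCompact N)
  obtain ⟨L, hL⟩ := hμL.exists_norm_sub_le fun t ht => (hY.compactConvex t ht).convex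
  have hvel : ∀ σ ∈ Icc a s', ∀ e ξ, ‖e‖ = 1 → ξ ∈ argmaxSet (Y σ) e →
      ⟪e, f (x σ) (w σ) + G (x σ) (μ σ (x σ))⟫_ℝ - minmaxRate f G U W e (Y σ) ≤
        (C + 2 * C ^ 2 + C * L : ℝ≥0) * (‖x σ - p σ‖ + ‖p σ - ξ‖ + ‖e - c σ‖) := by
    intro σ hσ e ξ he hξ
    have hσ' := hsub (hasub hσ)
    exact hC.inner_velocity_sub_minmaxRate_le hf hG.continuous hU hW
      (hY.compactConvex σ hσ').compact (Or.inl (mem_image_of_mem x (hasub hσ)))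
      (hYN σ hσ' (hfoot σ hσ).mem) (hYN σ hσ' hξ.1) he (hfoot σ hσ).norm_eq hξ
      (hw.2 σ (hasub hσ)) (hμU σ hσ' _)
      (hμ.mem_argmaxSet_of_isFoot hσ' (hY.compactConvex σ hσ') (hs σ hσ') (hfoot σ hσ))
      (hL σ hσ' _ _ _ (hfoot σ hσ))
  have hxa' : AbsolutelyContinuousOnInterval x a s' :=
    hx.mono (by rwa [uIcc_of_le ha.2.le, uIcc_of_le hss])
  exact hxs' (hY.mem_of_forall_isFoot hs ha.2.le (hs₁.trans ha.1) hs₂ hxa'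
    (ae_restrict_of_ae_restrict_of_subset hasub hx') hxa hfoot hvel s' (right_mem_Icc.2 ha.2.le))

end Invariance

end RobustTube

theorem corollary1_general {nx nu nw : ℕ}
    (f : RobustTube.E nx → RobustTube.E nw → RobustTube.E nx)
    (G : RobustTube.E nx → RobustTube.E nu →L[ℝ] RobustTube.E nx)
    (U : Set (RobustTube.E nu)) (W : Set (RobustTube.E nw))
    (t₁ t₂ : ℝ) (Y : ℝ → Set (RobustTube.E nx))
    (hU : RobustTube.IsCompactConvex U)
    (hW : IsCompact W)
    (hf : Continuous (Function.uncurry f)) (hfL : RobustTube.LocallyLipschitzInState f)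
    (hG : LocallyLipschitz G)
    (hY : RobustTube.SatisfiesMinmaxDI f G U W t₁ t₂ Y)
    (hUsm : RobustTube.IsSmoothPositivelyCurved U)
    (hYsm : ∀ t ∈ Set.Icc t₁ t₂, RobustTube.IsSmoothPositivelyCurved (Y t)) :
    (∀ t ∈ Set.Icc t₁ t₂,
      Set.BijOn (RobustTube.gaussMap (Y t)) (frontier (Y t))
        (Metric.sphere (0 : RobustTube.E nx) 1) ∧
      ∀ c ∈ Metric.sphere (0 : RobustTube.E nx) 1,
        RobustTube.argmaxSet (Y t) c = {RobustTube.invGaussMap (Y t) c}) ∧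
    (∀ t ∈ Set.Icc t₁ t₂, ∀ c ∈ Metric.sphere (0 : RobustTube.E nx) 1,
      (RobustTube.argminSet G U (Y t) c).Nonempty ∧
      (ContinuousLinearMap.adjoint (G (RobustTube.invGaussMap (Y t) c)) c ≠ 0 →
        (RobustTube.argminSet G U (Y t) c).Subsingleton)) ∧
    (∃ μ : ℝ → RobustTube.E nx → RobustTube.E nu,
      RobustTube.IsFeedbackLaw U t₁ t₂ μ ∧
      RobustTube.FollowsExplicitLaw G U t₁ t₂ Y μ ∧
      RobustTube.LipschitzOutwards t₁ t₂ Y μ) ∧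
    (∀ μ : ℝ → RobustTube.E nx → RobustTube.E nu,
      (∀ t ∈ Set.Icc t₁ t₂, ∀ ξ, μ t ξ ∈ U) →
      RobustTube.FollowsExplicitLaw G U t₁ t₂ Y μ →
      RobustTube.LipschitzOutwards t₁ t₂ Y μ →
      RobustTube.KeepsInTube f G W t₁ t₂ Y μ) := by
  refine ⟨fun t ht => ?_, fun t _ c _ => ?_,
    RobustTube.exists_feedbackLaw hU hUsm hG.continuous hY.isContinuousFamilyOn hYsm,
    fun μ hμU hμ hμL =>
      RobustTube.keepsInTube_of_followsExplicitLaw hU.compact hW hf hfL hG hY hYsm hμU hμ hμL⟩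
  · have hYt := hY.compactConvex t ht
    exact ⟨hYt.bijOn_gaussMap (hYsm t ht),
      fun c hc => hYt.argmaxSet_eq_singleton (hYsm t ht) (by simpa using hc)⟩
  · rw [RobustTube.argminSet_eq]
    exact ⟨hU.argmaxSet_nonempty _, fun h => hU.argmaxSet_subsingleton hUsm (neg_ne_zero.2 h)⟩

theorem corollary1 {nx nu nw : ℕ}
    (f : RobustTube.E nx → RobustTube.E nw → RobustTube.E nx)
    (G : RobustTube.E nx → RobustTube.E nu →L[ℝ] RobustTube.E nx)
    (U : Set (RobustTube.E nu)) (W : Set (RobustTube.E nw))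
    (t₁ t₂ : ℝ) (Y : ℝ → Set (RobustTube.E nx))
    -- standing assumptions on the control and disturbance sets and on the system
    (hU : RobustTube.IsCompactConvex U) (hUint : (interior U).Nonempty)
    (hW : RobustTube.IsCompactConvex W)
    (hf : Continuous (Function.uncurry f)) (hfL : RobustTube.LocallyLipschitzInState f)
    (hG : ContDiff ℝ 1 G)
    -- the conditions on the tube
    (hY : RobustTube.SatisfiesMinmaxDI f G U W t₁ t₂ Y)
    -- the additional regularity conditions
    (hUsm : RobustTube.IsSmoothPositivelyCurved U)
    (hYsm : ∀ t ∈ Set.Icc t₁ t₂, RobustTube.IsSmoothPositivelyCurved (Y t)) :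
    -- the Gauss maps of the cross-sections are invertible, the inverse being given by the argmax
    (∀ t ∈ Set.Icc t₁ t₂,
      Set.BijOn (RobustTube.gaussMap (Y t)) (frontier (Y t))
        (Metric.sphere (0 : RobustTube.E nx) 1) ∧
      ∀ c ∈ Metric.sphere (0 : RobustTube.E nx) 1,
        RobustTube.argmaxSet (Y t) c = {RobustTube.invGaussMap (Y t) c}) ∧
    -- the minimization has a solution, unique unless its objective vanishes identically
    (∀ t ∈ Set.Icc t₁ t₂, ∀ c ∈ Metric.sphere (0 : RobustTube.E nx) 1,
      (RobustTube.argminSet G U (Y t) c).Nonempty ∧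
      (ContinuousLinearMap.adjoint (G (RobustTube.invGaussMap (Y t) c)) c ≠ 0 →
        (RobustTube.argminSet G U (Y t) c).Subsingleton)) ∧
    -- there are feedback laws given by the formula, and all of them keep trajectories in the tube
    (∃ μ : ℝ → RobustTube.E nx → RobustTube.E nu,
      RobustTube.IsFeedbackLaw U t₁ t₂ μ ∧
      RobustTube.FollowsExplicitLaw G U t₁ t₂ Y μ ∧
      RobustTube.LipschitzOutwards t₁ t₂ Y μ) ∧
    (∀ μ : ℝ → RobustTube.E nx → RobustTube.E nu,
      RobustTube.IsFeedbackLaw U t₁ t₂ μ →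
      RobustTube.FollowsExplicitLaw G U t₁ t₂ Y μ →
      RobustTube.LipschitzOutwards t₁ t₂ Y μ →
      RobustTube.KeepsInTube f G W t₁ t₂ Y μ) := by
  obtain ⟨hGauss, hargmin, hexists, hkeeps⟩ := corollary1_general f G U W t₁ t₂ Y hU hW.compact
    hf hfL hG.locallyLipschitz hY hUsm hYsm
  exact ⟨hGauss, hargmin, hexists, fun μ hμ => hkeeps μ hμ.mem⟩
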